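/- Let $s\ge 2$ be an integer, let $\mathbb{Z}_s=\varprojlim \mathbb{Z}/s^n\mathbb{Z}$ be the compact ring of $s$-adic integers $x=\sum_{j\ge 0}x_js^j$, $0\le x_j\le s-1$ (with the inverse limit topology), and let $\mathbb{Z}_s^\times=\{x\in\mathbb{Z}_s : x_0\ne 0\}=\{x : |x|_s=1\}$, which is a closed and open subset of $\mathbb{Z}_s$. Let $\{E_l\}_{l\in\mathbb{Z}}$ be the canonical basis of $\ell^2(\mathbb{Z})$. On $\ell^2(\mathbb{Z})$ consider the $s$-adic shift $VE_l=E_{sl}$, the bilateral shift $vE_l=E_{l+1}$ and, for $f\in C(\mathbb{Z}_s)$, the operators $M_fE_l=f(l)E_l$ and $m_fE_l=f(0)E_l$. Let $HS(s)=C^*(V,M_f : f\in C(\mathbb{Z}_s))\subseteq B(\ell^2(\mathbb{Z}))$ be the Hensel-Steinitz algebra and let $\mathcal{K}$ be the C$^*$-algebra of compact operators on $\ell^2(\mathbb{Z})$. There is a $*$-isomorphism $C^*(v,m_f : f\in C(\mathbb{Z}_s))\cong C(\mathbb{R}/\mathbb{Z})$ sending $v$ to the function $t\mapsto e^{2\pi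 i t}$, and, under this identification, there is a unique unital $*$-homomorphism $\pi_0:HS(s)\to C(\mathbb{R}/\mathbb{Z})$ with $\pi_0(V)=v$ and $\pi_0(M_f)=m_f$ for all $f\in C(\mathbb{Z}_s)$; it is surjective. Its kernel $I_s=\ker\pi_0$ is isomorphic, as a C$^*$-algebra, to $C(\mathbb{Z}_s^\times)\otimes\mathcal{K}$ (the C$^*$-algebra tensor product). Consequently there is a short exact sequence of C$^*$-algebras $$0\to C(\mathbb{Z}_s^\times)\otimes\mathcal{K}\to HS(s)\xrightarrow{\ \pi_0\ } C(\mathbb{R}/\mathbb{Z})\to 0 .$$ -/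

import Mathlib

open scoped ENNReal TensorProduct

noncomputable section

namespace HenselSteinitz

/-! ### The ring of `s`-adic integers -/

/-- The ring `ℤ_s` of `s`-adic integers, `s` an arbitrary natural number (not necessarily prime):
the inverse limit of the rings `ℤ/sⁿℤ`, as a subring of their product. It carries the topology
induced by the product of the discrete topologies. The component `x.1 n` is the residue
`x₀ + x₁ s + ⋯ + xₙ₋₁ sⁿ⁻¹` of `x = ∑ xⱼ sʲ` modulo `sⁿ`. -/
def SAdicInt (s : ℕ) : Subring ((n : ℕ) → ZMod (s ^ n)) where
  carrier := {x | ∀ m n : ℕ, ∀ h : m ≤ n, ZMod.castHom (pow_dvd_pow s h) (ZMod (s ^ m)) (x n) = x m}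
  mul_mem' {x y} hx hy m n h := by
    rw [Pi.mul_apply, map_mul, hx m n h, hy m n h, Pi.mul_apply]
  one_mem' m n h := by rw [Pi.one_apply, map_one, Pi.one_apply]
  add_mem' {x y} hx hy m n h := by
    rw [Pi.add_apply, map_add, hx m n h, hy m n h, Pi.add_apply]
  zero_mem' m n h := by rw [Pi.zero_apply, map_zero, Pi.zero_apply]
  neg_mem' {x} hx m n h := by rw [Pi.neg_apply, map_neg, hx m n h, Pi.neg_apply]

instance instNeZeroOfTwoLe (s : ℕ) [h : Fact (2 ≤ s)] : NeZero s :=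
  ⟨by have := h.out; omega⟩

theorem isClosed_sAdicInt (s : ℕ) :
    IsClosed (SAdicInt s : Set ((n : ℕ) → ZMod (s ^ n))) := by
  have : (SAdicInt s : Set ((n : ℕ) → ZMod (s ^ n))) = ⋂ m : ℕ, ⋂ n : ℕ, ⋂ h : m ≤ n,
      {x | ZMod.castHom (pow_dvd_pow s h) (ZMod (s ^ m)) (x n) = x m} := by
    ext x
    simp [SAdicInt]
  rw [this]
  refine isClosed_iInter fun m => isClosed_iInter fun n => isClosed_iInter fun h => ?_
  exact isClosed_eq (continuous_of_discreteTopology.comp (continuous_apply n)) (continuous_apply m)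

instance instCompactSpaceSAdicInt (s : ℕ) [Fact (2 ≤ s)] : CompactSpace (SAdicInt s) :=
  isCompact_iff_compactSpace.mp (isClosed_sAdicInt s).isCompact

/-- The unit sphere `ℤ_s^×` of `ℤ_s`: the `x` with `|x|_s = 1`, that is, those whose zeroth digit
(the residue modulo `s`) does not vanish. If `s` is not prime, this is larger than the group of
invertible elements. -/
def UnitSphere (s : ℕ) : Set (SAdicInt s) := {x | x.1 1 ≠ 0}

theorem isClosed_unitSphere (s : ℕ) : IsClosed (UnitSphere s) := by
  have h : Continuous fun x : SAdicInt s => x.1 1 :=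
    (continuous_apply 1).comp continuous_subtype_val
  exact (isClosed_discrete ({0}ᶜ : Set (ZMod (s ^ 1)))).preimage h

instance instCompactSpaceUnitSphere (s : ℕ) [Fact (2 ≤ s)] : CompactSpace (UnitSphere s) :=
  isCompact_iff_compactSpace.mp (isClosed_unitSphere s).isCompact

/-! ### Operators on `ℓ²` -/

/-- The Hilbert space `ℓ²(ι)`. -/
abbrev L2 (ι : Type) : Type := lp (fun _ : ι => ℂ) 2

/-- The canonical basis vector `E_l` of `ℓ²(ι)`. -/
def basisVec {ι : Type} (l : ι) : L2 ι := by
  classical exact lp.single 2 l 1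

/-- Bounded operators on a Hilbert space. -/
abbrev BddOp (H : Type) [NormedAddCommGroup H] [InnerProductSpace ℂ H] : Type := H →L[ℂ] H

theorem orthonormal_basisVec {ι : Type} : Orthonormal ℂ (basisVec : ι → L2 ι) := by
  classical
  rw [orthonormal_iff_ite]
  intro i j
  simp only [basisVec, lp.inner_single_left, lp.single_apply]
  by_cases h : i = j
  · subst h; simp
  · simp [h]

/-- For an injective map `φ : ι → ι`, the isometry `E_l ↦ E_{φ l}` of `ℓ²(ι)`. -/
def basisShift {ι : Type} (φ : ι → ι) (hφ : Function.Injective φ) : BddOp (L2 ι) :=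
  ((orthonormal_basisVec.comp φ hφ).orthogonalFamily.linearIsometry).toContinuousLinearMap

theorem basisShift_basisVec {ι : Type} (φ : ι → ι) (hφ : Function.Injective φ) (l : ι) :
    basisShift φ hφ (basisVec l) = basisVec (φ l) := by
  classical
  simp only [basisShift, LinearIsometry.coe_toContinuousLinearMap]
  have h : (basisVec l : L2 ι) = lp.single 2 l (1 : ℂ) := by
    simp only [basisVec]
  rw [h, OrthogonalFamily.linearIsometry_apply_single]
  simp

/-- For a continuous function `f` on a compact space `X` and a map `φ : ι → X`, the diagonal
operator `E_l ↦ f (φ l) E_l` on `ℓ²(ι)`; as a function of `f` this is a representation of `C(X)`. -/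
def diagRep {ι : Type} {X : Type} [TopologicalSpace X] [CompactSpace X] (φ : ι → X) :
    C(X, ℂ) →⋆ₐ[ℂ] BddOp (L2 ι) where
  toFun f := lp.mapCLM 2 (fun l : ι => f (φ l) • ContinuousLinearMap.id ℂ ℂ) (norm_nonneg f)
    (fun l => by
      refine (norm_smul_le _ _).trans ?_
      simpa using f.norm_coe_le_norm (φ l))
  map_one' := by ext; simp
  map_mul' f g := by ext; simp [mul_assoc]
  map_zero' := by ext; simp
  map_add' f g := by ext; simp [add_mul]
  commutes' r := by ext; simp [Algebra.algebraMap_eq_smul_one]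
  map_star' f := by
    rw [ContinuousLinearMap.star_eq_adjoint, ContinuousLinearMap.eq_adjoint_iff]
    intro x y
    rw [lp.inner_eq_tsum, lp.inner_eq_tsum]
    refine tsum_congr fun l => ?_
    simp
    ring

theorem diagRep_apply {ι : Type} {X : Type} [TopologicalSpace X] [CompactSpace X] (φ : ι → X)
    (f : C(X, ℂ)) (x : L2 ι) (l : ι) : diagRep φ f x l = f (φ l) * x l := by
  simp [diagRep]

theorem diagRep_basisVec {ι : Type} {X : Type} [TopologicalSpace X] [CompactSpace X] (φ : ι → X)
    (f : C(X, ℂ)) (l : ι) : diagRep φ f (basisVec l) = f (φ l) • basisVec l := by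
  classical
  ext k
  rw [diagRep_apply]
  by_cases h : k = l
  · subst h; simp
  · simp [basisVec, lp.single_apply, h]

theorem isCompactOperator_adjoint {H : Type} [NormedAddCommGroup H] [InnerProductSpace ℂ H]
    [CompleteSpace H] {T : BddOp H} (hT : IsCompactOperator T) :
    IsCompactOperator (star T : BddOp H) := by
  have h1 : IsCompactOperator (T * star T) := hT.comp_clm (star T)
  have h2 := (isCompactOperator_iff_isCompact_closure_image_closedBall
    ((T * star T : BddOp H) : H →ₗ[ℂ] H) one_pos).1 h1
  refine (isCompactOperator_iff_isCompact_closure_image_closedBall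
    ((star T : BddOp H) : H →ₗ[ℂ] H) one_pos).2 ?_
  refine TotallyBounded.isCompact_of_isClosed (TotallyBounded.closure ?_) isClosed_closure
  have h3 := h2.totallyBounded.subset subset_closure
  rw [Metric.totallyBounded_iff]
  intro ε hε
  obtain ⟨t, hts, htf, ht⟩ := Metric.finite_approx_of_totallyBounded h3 (ε ^ 2 / 2) (by positivity)
  have hts' : ∀ y ∈ t, ∃ b, b ∈ Metric.closedBall (0 : H) 1 ∧ (T * star T) b = y :=
    fun y hy => hts hy
  choose! b hb hbt using hts'
  refine ⟨(fun y => star T (b y)) '' t, htf.image _, ?_⟩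
  rintro _ ⟨x, hx, rfl⟩
  have hxy := ht ⟨x, hx, rfl⟩
  simp only [Set.mem_iUnion, exists_prop] at hxy
  obtain ⟨y, hy, hxy⟩ := hxy
  simp only [Set.mem_iUnion, exists_prop]
  refine ⟨_, ⟨y, hy, rfl⟩, ?_⟩
  have hby : (T * star T) (b y) = y := hbt y hy
  rw [Metric.mem_ball, dist_eq_norm] at hxy ⊢
  have hxy' : ‖(T * star T) (x - b y)‖ < ε ^ 2 / 2 := by
    rw [map_sub, hby]; exact hxy
  have hd : ‖x - b y‖ ≤ 2 := by
    have h5 := norm_sub_le x (b y)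
    have h6 : ‖x‖ ≤ 1 := by simpa using hx
    have h7 : ‖b y‖ ≤ 1 := by simpa using hb y hy
    linarith
  have key : ‖star T (x - b y)‖ ^ 2 ≤ ‖(T * star T) (x - b y)‖ * ‖x - b y‖ := by
    have h8 := T.apply_norm_sq_eq_inner_adjoint_left (x - b y)
    have h9 := (ContinuousLinearMap.adjoint T).apply_norm_sq_eq_inner_adjoint_left (x - b y)
    rw [ContinuousLinearMap.adjoint_adjoint] at h9
    rw [ContinuousLinearMap.star_eq_adjoint, h9]
    exact (RCLike.re_le_norm _).trans (norm_inner_le_norm _ _)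
  have h10 : ‖star T (x - b y)‖ ^ 2 < ε ^ 2 := by
    nlinarith [norm_nonneg ((T * star T) (x - b y)), norm_nonneg (x - b y)]
  have h11 := lt_of_pow_lt_pow_left₀ 2 hε.le h10
  rw [map_sub] at h11
  exact h11

/-- The C*-algebra `K(H)` of compact operators on a Hilbert space. -/
def compactOps (H : Type) [NormedAddCommGroup H] [InnerProductSpace ℂ H] [CompleteSpace H] :
    NonUnitalStarSubalgebra ℂ (BddOp H) where
  carrier := {T | IsCompactOperator T}
  add_mem' ha hb := ha.add hb
  zero_mem' := isCompactOperator_zero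
  mul_mem' {_ b} ha _ := ha.comp_clm b
  smul_mem' c _ ha := ha.smul c
  star_mem' hT := isCompactOperator_adjoint hT

/-! ### Spatial tensor products -/

/-- The Hilbert space tensor product: the completion of the algebraic tensor product for the inner
product with `⟪x ⊗ y, x' ⊗ y'⟫ = ⟪x, x'⟫ ⟪y, y'⟫`. -/
abbrev HilbertTensor (H K : Type) [NormedAddCommGroup H] [InnerProductSpace ℂ H]
    [NormedAddCommGroup K] [InnerProductSpace ℂ K] : Type :=
  UniformSpace.Completion (H ⊗[ℂ] K)

/-- The bounded operator `S ⊗ T` on the Hilbert space tensor product,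
with `(S ⊗ T) (x ⊗ y) = S x ⊗ T y`. -/
def tensorOp {H K : Type} [NormedAddCommGroup H] [InnerProductSpace ℂ H]
    [NormedAddCommGroup K] [InnerProductSpace ℂ K] (S : BddOp H) (T : BddOp K) :
    BddOp (HilbertTensor H K) :=
  (TensorProduct.mapL S T).completion

theorem tensorOp_tmul {H K : Type} [NormedAddCommGroup H] [InnerProductSpace ℂ H]
    [NormedAddCommGroup K] [InnerProductSpace ℂ K] (S : BddOp H) (T : BddOp K) (x : H) (y : K) :
    tensorOp S T ((x ⊗ₜ[ℂ] y : H ⊗[ℂ] K) : HilbertTensor H K) =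
      ((S x ⊗ₜ[ℂ] T y : H ⊗[ℂ] K) : HilbertTensor H K) := by
  simp [tensorOp]

/-- The spatial (minimal) C*-tensor product of two concrete C*-algebras `A ⊆ B(H)`, `B ⊆ B(K)`:
the norm-closed `*`-algebra of operators on the Hilbert space tensor product of `H` and `K` that is
generated by all `S ⊗ T`, `S ∈ A`, `T ∈ B`. -/
def spatialTensor {H K : Type} [NormedAddCommGroup H] [InnerProductSpace ℂ H] [CompleteSpace H]
    [NormedAddCommGroup K] [InnerProductSpace ℂ K] [CompleteSpace K]
    (A : NonUnitalStarSubalgebra ℂ (BddOp H)) (B : NonUnitalStarSubalgebra ℂ (BddOp K)) :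
    NonUnitalStarSubalgebra ℂ (BddOp (HilbertTensor H K)) :=
  (NonUnitalStarAlgebra.adjoin ℂ
    {R | ∃ S ∈ A, ∃ T ∈ B, R = tensorOp S T}).topologicalClosure

/-- The C*-algebra `C(X)` of a compact space, faithfully represented on `ℓ²(X)` by multiplication
operators `E_x ↦ f(x) E_x`. -/
def contAlg (X : Type) [TopologicalSpace X] [CompactSpace X] :
    NonUnitalStarSubalgebra ℂ (BddOp (L2 X)) :=
  NonUnitalStarAlgHom.range
    ((diagRep (id : X → X) : C(X, ℂ) →⋆ₐ[ℂ] BddOp (L2 X)) : C(X, ℂ) →⋆ₙₐ[ℂ] BddOp (L2 X))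

theorem diagRep_id_injective (X : Type) [TopologicalSpace X] [CompactSpace X] :
    Function.Injective (diagRep (id : X → X)) := by
  classical
  intro f g h
  ext x
  have h1 := congrArg (fun T : BddOp (L2 X) => (T (basisVec x) : L2 X) x) h
  simpa [diagRep_apply, basisVec] using h1

/-- The C*-algebra `C(ℤ_s^×) ⊗ K`, with `K` the compact operators on `ℓ²(ℤ)`. -/
def contTensorCompact (s : ℕ) [Fact (2 ≤ s)] :
    NonUnitalStarSubalgebra ℂ (BddOp (HilbertTensor (L2 (UnitSphere s)) (L2 ℤ))) :=
  spatialTensor (contAlg (UnitSphere s)) (compactOps (L2 ℤ))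

/-! ### The Hensel-Steinitz algebra -/

/-- The operator `M_f E_l = f(l) E_l` on `ℓ²(ℤ)`, for `f ∈ C(ℤ_s)`. -/
def opM {s : ℕ} [Fact (2 ≤ s)] (f : C(SAdicInt s, ℂ)) : BddOp (L2 ℤ) :=
  diagRep (fun l : ℤ => (l : SAdicInt s)) f

/-- The operator `m_f E_l = f(0) E_l` on `ℓ²(ℤ)`, for `f ∈ C(ℤ_s)`. -/
def opm {s : ℕ} [Fact (2 ≤ s)] (f : C(SAdicInt s, ℂ)) : BddOp (L2 ℤ) :=
  diagRep (fun _ : ℤ => (0 : SAdicInt s)) f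

/-- The `s`-adic shift `V E_l = E_{s l}` on `ℓ²(ℤ)`. -/
def opV (s : ℕ) [Fact (2 ≤ s)] : BddOp (L2 ℤ) :=
  basisShift (fun l : ℤ => (s : ℤ) * l)
    (mul_right_injective₀ (Int.natCast_ne_zero.mpr (NeZero.ne s)))

/-- The bilateral shift `v E_l = E_{l + 1}` on `ℓ²(ℤ)`. -/
def opv : BddOp (L2 ℤ) :=
  basisShift (fun l : ℤ => l + 1) (add_left_injective 1)

/-- The Hensel-Steinitz algebra `HS(s)`: the C*-algebra of operators on `ℓ²(ℤ)` generated by the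
`s`-adic shift `V` and the operators `M_f`, `f ∈ C(ℤ_s)`. -/
def HS (s : ℕ) [Fact (2 ≤ s)] : StarSubalgebra ℂ (BddOp (L2 ℤ)) :=
  (StarAlgebra.adjoin ℂ
    ({opV s} ∪ Set.range (opM : C(SAdicInt s, ℂ) → BddOp (L2 ℤ)))).topologicalClosure

/-- The C*-algebra `C*(v, m_f : f ∈ C(ℤ_s))` of operators on `ℓ²(ℤ)`. -/
def shiftAlg (s : ℕ) [Fact (2 ≤ s)] : StarSubalgebra ℂ (BddOp (L2 ℤ)) :=
  (StarAlgebra.adjoin ℂ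
    ({opv} ∪ Set.range (opm : C(SAdicInt s, ℂ) → BddOp (L2 ℤ)))).topologicalClosure

/-- `V` as an element of `HS(s)`. -/
def genV (s : ℕ) [Fact (2 ≤ s)] : HS s :=
  ⟨opV s, StarSubalgebra.le_topologicalClosure _ (StarAlgebra.subset_adjoin ℂ _ (Or.inl rfl))⟩

/-- `M_f` as an element of `HS(s)`. -/
def genM {s : ℕ} [Fact (2 ≤ s)] (f : C(SAdicInt s, ℂ)) : HS s :=
  ⟨opM f, StarSubalgebra.le_topologicalClosure _
    (StarAlgebra.subset_adjoin ℂ _ (Or.inr ⟨f, rfl⟩))⟩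

/-- The kernel of a `*`-homomorphism, as a `*`-algebra in its own right. -/
def starKer {A B : Type} [Ring A] [StarRing A] [Algebra ℂ A] [Ring B] [StarRing B] [Algebra ℂ B]
    (π : A →⋆ₐ[ℂ] B) : NonUnitalStarSubalgebra ℂ A where
  carrier := {a | π a = 0}
  add_mem' {a b} (ha : π a = 0) (hb : π b = 0) :=
    show π (a + b) = 0 by rw [map_add, ha, hb, add_zero]
  zero_mem' := map_zero π
  mul_mem' {a b} (ha : π a = 0) _ := show π (a * b) = 0 by rw [map_mul, ha, zero_mul]
  smul_mem' c a (ha : π a = 0) := show π (c • a) = 0 by rw [map_smul, ha, smul_zero]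
  star_mem' {a} (ha : π a = 0) := show π (star a) = 0 by rw [map_star, ha, star_zero]

end HenselSteinitz

end

open HenselSteinitz

noncomputable section

namespace HenselSteinitz

open Filter Topology InnerProductSpace

/-! ### Operators determined by the canonical basis -/

section Basis

variable {ι : Type}

/-! Every nonzero integer is uniquely `s ^ k * m` with `s ∤ m`, so `ℓ²(ℤ)` is the sum of `ℂ E_0` and
one copy of `ℓ²(ℕ)` for each such `m`. On the copy of `m`, `V` is the unilateral shift and `M_f` is
diagonal with entries `f (s ^ k m)`, which tend to `f 0`. Thus `HS(s)` is a Toeplitz-type extension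
of the circle algebra.

The map `π₀` is the limit at infinity along the orbit of `1`. With the isometries `W_n E_k = E_{s ^
(n + k)}`, the pairs `(T, g)` such that `T W_n - W_n g(v) → 0` strongly, together with the same for
adjoints, form a closed `*`-algebra (`limitGraph`). It is single-valued because each `W_n` is
isometric and `g ↦ g(v)` is faithful, the spectrum of `v` being the whole circle. It contains the
generators, and its projection to the first factor is an injective `*`-homomorphism, so the image is
closed and contains `HS(s)`.

For the kernel, let `J` (`sphereIdeal`) be the closed span of `V ^ i M_f V* ^ j` with `f` supported
on the unit sphere. It is an ideal of `HS(s)`, and `π₀` kills it since `f 0 = 0`. Conversely, the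
linear section `g ↦ g(V)` (`toeplitz`) satisfies `T - (π₀ T)(V) ∈ J` for all `T`
(`sub_toeplitz_mem_sphereIdeal`): this holds for the generators and passes to products because the
section is multiplicative modulo `J`. Hence `ker π₀ = J`.

Finally `V ^ i M_f V* ^ j` kills `E_0` and acts on the orbit of `m` as `f m` times a matrix unit. So
`J` is the image of `C(ℤ_s^×, K)` under a block diagonal representation, faithful because the
integers not divisible by `s` are dense in the sphere. The spatial tensor product is the image of
the same algebra under the blocks `E_x ⊗ ℓ²(ℤ)`, so the two are isomorphic. -/

theorem basisVec_apply [DecidableEq ι] (l k : ι) :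
    (basisVec l : L2 ι) k = if k = l then 1 else 0 := by
  by_cases h : k = l
  · subst h; simp [basisVec]
  · simp [basisVec, lp.single_apply, h]

theorem inner_basisVec_left (l : ι) (x : L2 ι) : inner ℂ (basisVec l) x = x l := by
  classical
  simp only [basisVec, lp.inner_single_left]
  simp

theorem inner_basisVec_basisVec [DecidableEq ι] (k l : ι) :
    inner ℂ (basisVec k : L2 ι) (basisVec l) = if k = l then 1 else 0 := by
  rw [inner_basisVec_left, basisVec_apply]

theorem norm_basisVec (l : ι) : ‖(basisVec l : L2 ι)‖ = 1 := orthonormal_basisVec.1 l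

theorem hasSum_basisVec (x : L2 ι) : HasSum (fun i => x i • (basisVec i : L2 ι)) x := by
  classical
  have h := lp.hasSum_single (p := 2) (by simp) x
  convert h using 2 with i
  ext k
  by_cases hk : k = i
  · subst hk; simp [basisVec]
  · simp [basisVec, lp.single_apply, hk]

theorem dense_span_basisVec :
    Dense (Submodule.span ℂ (Set.range (basisVec : ι → L2 ι)) : Set (L2 ι)) := by
  intro x
  refine mem_closure_of_tendsto (hasSum_basisVec x) (Eventually.of_forall fun S => ?_)
  exact Submodule.sum_mem _ fun i _ => Submodule.smul_mem _ _ (Submodule.subset_span ⟨i, rfl⟩)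

theorem ext_basisVec {F : Type} [NormedAddCommGroup F] [NormedSpace ℂ F] {S T : L2 ι →L[ℂ] F}
    (h : ∀ l, S (basisVec l) = T (basisVec l)) : S = T :=
  ContinuousLinearMap.ext_on dense_span_basisVec (by rintro _ ⟨l, rfl⟩; exact h l)

theorem ext_inner_basisVec {x y : L2 ι}
    (h : ∀ l, inner ℂ (basisVec l) x = inner ℂ (basisVec l) y) : x = y := by
  ext l
  simpa only [inner_basisVec_left] using h l

theorem basisShift_isometry (φ : ι → ι) (hφ : Function.Injective φ) (x : L2 ι) :
    ‖basisShift φ hφ x‖ = ‖x‖ :=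
  ((orthonormal_basisVec.comp φ hφ).orthogonalFamily.linearIsometry).norm_map x

theorem star_basisShift_mul_self (φ : ι → ι) (hφ : Function.Injective φ) :
    star (basisShift φ hφ) * basisShift φ hφ = 1 :=
  (ContinuousLinearMap.inner_map_map_iff_adjoint_comp_self _).1
    ((orthonormal_basisVec.comp φ hφ).orthogonalFamily.linearIsometry).inner_map_map

theorem star_basisShift_basisVec (φ : ι → ι) (hφ : Function.Injective φ) (l : ι) :
    star (basisShift φ hφ) (basisVec (φ l)) = basisVec l := by
  rw [← basisShift_basisVec φ hφ l, ← mul_apply_eq_comp, star_basisShift_mul_self]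
  rfl

theorem star_basisShift_basisVec_of_notMem (φ : ι → ι) (hφ : Function.Injective φ) (l : ι)
    (hl : l ∉ Set.range φ) : star (basisShift φ hφ) (basisVec l) = 0 := by
  classical
  refine ext_inner_basisVec fun k => ?_
  rw [ContinuousLinearMap.star_eq_adjoint, ContinuousLinearMap.adjoint_inner_right,
    basisShift_basisVec, inner_basisVec_basisVec, if_neg (fun h => hl ⟨k, h⟩), inner_zero_right]

theorem basisShift_mem_unitary (φ : ι → ι) (hφ : Function.Bijective φ) :
    basisShift φ hφ.1 ∈ unitary (BddOp (L2 ι)) := by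
  refine ⟨star_basisShift_mul_self φ hφ.1, ext_basisVec fun l => ?_⟩
  obtain ⟨k, rfl⟩ := hφ.2 l
  rw [mul_apply_eq_comp, star_basisShift_basisVec, basisShift_basisVec]
  rfl

end Basis

/-! ### Approximation of compact operators by finite matrices -/

/-- Comparison with a finite `ε / 3`-net makes the pointwise convergence uniform. It serves for
projections on the image of a ball and for compressions on the range of a section. -/
theorem eventually_forall_dist_lt_of_lipschitz {κ α : Type*} [PseudoMetricSpace α] {l : Filter κ}
    {A : κ → α → α} (hA : ∀ i, LipschitzWith 1 (A i)) {C : Set α} (hC : TotallyBounded C)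
    (h : ∀ y ∈ C, Tendsto (fun i => A i y) l (𝓝 y)) {ε : ℝ} (hε : 0 < ε) :
    ∀ᶠ i in l, ∀ y ∈ C, dist (A i y) y < ε := by
  obtain ⟨t, htC, htf, ht⟩ := Metric.finite_approx_of_totallyBounded hC (ε / 3) (by positivity)
  have h1 : ∀ᶠ i in l, ∀ z ∈ t, dist (A i z) z < ε / 3 :=
    (htf.eventually_all).2 fun z hz => (Metric.tendsto_nhds.1 (h z (htC hz))) _ (by positivity)
  filter_upwards [h1] with i hi y hy
  obtain ⟨z, hz, hyz⟩ := Set.mem_iUnion₂.1 (ht hy)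
  rw [Metric.mem_ball] at hyz
  have h2 := (hA i).dist_le_mul y z
  have h3 := dist_triangle4 (A i y) (A i z) z y
  rw [dist_comm z y] at h3
  have h4 := hi z hz
  simp only [NNReal.coe_one, one_mul] at h2
  linarith

section Compact

variable {ι : Type}

/-- The rank one operator `E_j ↦ E_i`. -/
def matrixUnit (i j : ι) : BddOp (L2 ι) := rankOne ℂ (basisVec i) (basisVec j)

theorem matrixUnit_basisVec [DecidableEq ι] (i j k : ι) :
    matrixUnit i j (basisVec k) = if j = k then basisVec i else 0 := by
  rw [matrixUnit, rankOne_apply, inner_basisVec_basisVec]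
  split_ifs <;> simp

theorem star_matrixUnit (i j : ι) : star (matrixUnit i j) = matrixUnit j i := by
  rw [ContinuousLinearMap.star_eq_adjoint, matrixUnit, adjoint_rankOne, matrixUnit]

theorem isCompactOperator_matrixUnit (i j : ι) : IsCompactOperator (matrixUnit i j) := by
  rw [matrixUnit, rankOne_def']
  exact (isCompactOperator_of_locallyCompactSpace_rng
    (.toSpanSingleton ℂ (basisVec i : L2 ι))).comp_clm (innerSL ℂ (basisVec j : L2 ι))

/-- The projection onto the coordinates in a finite set. -/
def coordProj (S : Finset ι) : BddOp (L2 ι) := ∑ i ∈ S, matrixUnit i i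

theorem coordProj_apply (S : Finset ι) (x : L2 ι) :
    coordProj S x = ∑ i ∈ S, x i • basisVec i := by
  simp [coordProj, matrixUnit, inner_basisVec_left]

theorem tendsto_coordProj (x : L2 ι) : Tendsto (fun S => coordProj S x) atTop (𝓝 x) := by
  simp only [coordProj_apply]
  exact hasSum_basisVec x

theorem star_coordProj (S : Finset ι) : star (coordProj S) = coordProj S := by
  simp [coordProj, star_sum, star_matrixUnit]

theorem norm_coordProj_le (S : Finset ι) : ‖coordProj S‖ ≤ 1 := by
  classical
  refine ContinuousLinearMap.opNorm_le_bound _ zero_le_one fun x => ?_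
  rw [one_mul]
  refine lp.norm_mono (by simp) fun k => ?_
  rw [coordProj_apply, lp.coeFn_sum, Finset.sum_apply]
  simp only [lp.coeFn_smul, Pi.smul_apply, basisVec_apply, smul_eq_mul, mul_ite, mul_one, mul_zero,
    Finset.sum_ite_eq]
  split_ifs <;> simp

/-- Strong convergence of the projections is uniform on the totally bounded image of the unit ball,
which is norm convergence. -/
theorem tendsto_coordProj_mul {T : BddOp (L2 ι)} (hT : IsCompactOperator T) :
    Tendsto (fun S => coordProj S * T) atTop (𝓝 T) := by
  rw [Metric.tendsto_nhds]
  intro ε hε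
  have hC := ((isCompactOperator_iff_isCompact_closure_image_closedBall
    (T : L2 ι →ₗ[ℂ] L2 ι) one_pos).1 hT).totallyBounded.subset subset_closure
  have hA (S : Finset ι) : LipschitzWith 1 (coordProj S) :=
    (coordProj S).lipschitz.weaken (norm_coordProj_le S)
  filter_upwards [eventually_forall_dist_lt_of_lipschitz hA hC
    (fun y _ => tendsto_coordProj y) (half_pos hε)] with S hS
  rw [dist_eq_norm]
  refine lt_of_le_of_lt ?_ (half_lt_self hε)
  refine ContinuousLinearMap.opNorm_le_of_unit_norm (𝕜 := ℂ) (half_pos hε).le fun x hx => ?_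
  have := hS (T x) ⟨x, by simp [hx], rfl⟩
  rw [dist_eq_norm] at this
  exact this.le

theorem tendsto_coordProj_conj {T : BddOp (L2 ι)} (hT : IsCompactOperator T) :
    Tendsto (fun S => coordProj S * T * coordProj S) atTop (𝓝 T) := by
  have h1 := tendsto_coordProj_mul hT
  -- Taking adjoints turns left multiplication by the projections into right multiplication.
  have h2 := (tendsto_coordProj_mul (isCompactOperator_adjoint hT)).star
  simp only [star_mul, star_star, star_coordProj] at h2
  rw [tendsto_iff_norm_sub_tendsto_zero] at h1 h2 ⊢
  refine squeeze_zero (fun _ => norm_nonneg _) (fun S => ?_) (by simpa using h2.add h1)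
  have : coordProj S * T * coordProj S - T =
      coordProj S * (T * coordProj S - T) + (coordProj S * T - T) := by
    rw [mul_sub, mul_assoc]; abel
  rw [this]
  refine (norm_add_le _ _).trans (add_le_add_left ?_ _)
  refine (norm_mul_le _ _).trans ?_
  exact mul_le_of_le_one_left (norm_nonneg _) (norm_coordProj_le S)

theorem coordProj_conj_eq (S : Finset ι) (T : BddOp (L2 ι)) :
    coordProj S * T * coordProj S =
      ∑ i ∈ S, ∑ j ∈ S, inner ℂ (basisVec i) (T (basisVec j)) • matrixUnit i j := by
  rw [coordProj, Finset.sum_mul, Finset.sum_mul]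
  refine Finset.sum_congr rfl fun i _ => ?_
  rw [Finset.mul_sum]
  refine Finset.sum_congr rfl fun j _ => ?_
  ext1 x
  simp [matrixUnit, smul_smul, mul_comm]

end Compact

/-! ### Continuous sections with values in the compact operators -/

section Sections

variable {X : Type} [TopologicalSpace X] [CompactSpace X] {ι : Type}

/-- The function `x ↦ f x • T`. -/
def elemSection (f : C(X, ℂ)) (T : BddOp (L2 ι)) : C(X, BddOp (L2 ι)) :=
  ⟨fun x => f x • T, by fun_prop⟩

omit [CompactSpace X] in
theorem elemSection_apply (f : C(X, ℂ)) (T : BddOp (L2 ι)) (x : X) :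
    elemSection f T x = f x • T := rfl

variable (X ι) in
/-- The C*-algebra `C(X, K)` of continuous functions with values in the compact operators. -/
def compactSections : NonUnitalStarSubalgebra ℂ C(X, BddOp (L2 ι)) where
  carrier := {F | ∀ x, F x ∈ compactOps (L2 ι)}
  add_mem' ha hb x := add_mem (ha x) (hb x)
  zero_mem' _ := zero_mem _
  mul_mem' ha hb x := mul_mem (ha x) (hb x)
  smul_mem' c _ ha x := (compactOps (L2 ι)).smul_mem' c (ha x)
  star_mem' ha x := star_mem (ha x)

theorem isClosed_compactOps :
    IsClosed ((compactOps (L2 ι) : NonUnitalStarSubalgebra ℂ (BddOp (L2 ι))) :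
      Set (BddOp (L2 ι))) :=
  isClosed_setOfPred_isCompactOperator

omit [CompactSpace X] in
theorem isClosed_compactSections : IsClosed (compactSections X ι : Set C(X, BddOp (L2 ι))) := by
  have : (compactSections X ι : Set C(X, BddOp (L2 ι))) =
      ⋂ x : X, (fun F : C(X, BddOp (L2 ι)) => F x) ⁻¹' (compactOps (L2 ι)) := by
    ext F; rw [Set.mem_iInter]; rfl
  rw [this]
  exact isClosed_iInter fun x => isClosed_compactOps.preimage (continuous_eval_const x)

omit [CompactSpace X] in
theorem elemSection_mem (f : C(X, ℂ)) {T : BddOp (L2 ι)} (hT : T ∈ compactOps (L2 ι)) :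
    elemSection f T ∈ compactSections X ι :=
  fun x => (compactOps (L2 ι)).smul_mem' (f x) hT

/-- The range of a section is compact, so the contractive compressions `P_S T P_S` converge
uniformly on it. A compressed section is a finite matrix of continuous scalar functions. -/
theorem compactSections_subset_closure_span :
    (compactSections X ι : Set C(X, BddOp (L2 ι))) ⊆
      closure (Submodule.span ℂ
        {F | ∃ (f : C(X, ℂ)) (i j : ι), F = elemSection f (matrixUnit i j)} : Set _) := by
  intro F hF
  rw [Metric.mem_closure_iff]
  intro ε hε
  have hA (S : Finset ι) : LipschitzWith 1
      (fun T : BddOp (L2 ι) => coordProj S * T * coordProj S) := by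
    refine LipschitzWith.of_dist_le_mul fun T T' => ?_
    rw [dist_eq_norm, dist_eq_norm, ← sub_mul, ← mul_sub, NNReal.coe_one, one_mul]
    refine (norm_mul_le _ _).trans ?_
    refine (mul_le_of_le_one_right (norm_nonneg _) (norm_coordProj_le S)).trans ?_
    refine (norm_mul_le _ _).trans ?_
    exact mul_le_of_le_one_left (norm_nonneg _) (norm_coordProj_le S)
  have hC : TotallyBounded (Set.range F) := (isCompact_range F.continuous).totallyBounded
  obtain ⟨S, hS⟩ := (eventually_forall_dist_lt_of_lipschitz hA hC
    (by rintro _ ⟨x, rfl⟩; exact tendsto_coordProj_conj (hF x)) (half_pos hε)).exists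
  let c (i j : ι) : C(X, ℂ) := ⟨fun x => inner ℂ (basisVec i) (F x (basisVec j)), by fun_prop⟩
  refine ⟨∑ i ∈ S, ∑ j ∈ S, elemSection (c i j) (matrixUnit i j), ?_, ?_⟩
  · exact Submodule.sum_mem _ fun i _ => Submodule.sum_mem _ fun j _ =>
      Submodule.subset_span ⟨_, _, _, rfl⟩
  · refine lt_of_le_of_lt ?_ (half_lt_self hε)
    rw [ContinuousMap.dist_le (half_pos hε).le]
    intro x
    have := (hS (F x) ⟨x, rfl⟩).le
    rw [coordProj_conj_eq, dist_comm] at this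
    simpa [c, elemSection_apply] using this

end Sections

/-- An injective `*`-homomorphism restricts to an isomorphism of a `*`-subalgebra onto its image. -/
def equivOfMapEq {A B : Type} [NonUnitalRing A] [StarRing A] [Module ℂ A]
    [NonUnitalRing B] [StarRing B] [Module ℂ B]
    (f : A →⋆ₙₐ[ℂ] B) (hf : Function.Injective f) (S : NonUnitalStarSubalgebra ℂ A)
    (T : NonUnitalStarSubalgebra ℂ B) (h : S.map f = T) : S ≃⋆ₐ[ℂ] T :=
  StarAlgEquiv.ofBijective
    (NonUnitalStarAlgHom.codRestrict
      (f.comp (NonUnitalStarSubalgebraClass.subtype S)) T fun F => h ▸ ⟨F, F.2, rfl⟩)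
    ⟨fun F G h => Subtype.ext (hf (congrArg Subtype.val h)), by
      subst h
      rintro ⟨_, F, hF, rfl⟩
      exact ⟨⟨F, hF⟩, rfl⟩⟩

/-- Two `*`-subalgebras whose images under injective `*`-homomorphisms are linked through a third
one are isomorphic. -/
theorem nonempty_equiv_of_map_eq {A B C D : Type} [Ring A] [StarRing A] [Algebra ℂ A]
    [Ring B] [StarRing B] [Algebra ℂ B] [Ring C] [StarRing C] [Algebra ℂ C]
    [Ring D] [StarRing D] [Algebra ℂ D]
    {f : A →⋆ₙₐ[ℂ] B} (hf : Function.Injective f) {g : C →⋆ₙₐ[ℂ] B} (hg : Function.Injective g)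
    {h : C →⋆ₙₐ[ℂ] D} (hh : Function.Injective h)
    {S : NonUnitalStarSubalgebra ℂ A} {R : NonUnitalStarSubalgebra ℂ C}
    {T : NonUnitalStarSubalgebra ℂ D} (h₁ : S.map f = R.map g) (h₂ : R.map h = T) :
    Nonempty (S ≃⋆ₐ[ℂ] T) :=
  ⟨((equivOfMapEq f hf S _ h₁).trans (equivOfMapEq g hg R _ rfl).symm).trans
    (equivOfMapEq h hh R T h₂)⟩

/-- An isomorphism of `*`-subalgebras composed with an inclusion. -/
theorem exists_injective_mem_range_iff {A B : Type} [Ring A] [StarRing A] [Algebra ℂ A]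
    [Ring B] [StarRing B] [Algebra ℂ B] {S : NonUnitalStarSubalgebra ℂ A}
    {T : NonUnitalStarSubalgebra ℂ B} (h : Nonempty (S ≃⋆ₐ[ℂ] T)) :
    ∃ j : T →⋆ₙₐ[ℂ] A, Function.Injective j ∧ ∀ a, a ∈ S ↔ a ∈ Set.range j := by
  obtain ⟨e⟩ := h
  refine ⟨(NonUnitalStarSubalgebraClass.subtype S).comp
    (e.symm : T →⋆ₙₐ[ℂ] S), Subtype.val_injective.comp e.symm.injective, fun a => ?_⟩
  exact ⟨fun ha => ⟨e ⟨a, ha⟩, congrArg Subtype.val (e.symm_apply_apply ⟨a, ha⟩)⟩,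
    fun ⟨t, ht⟩ => ht ▸ (e.symm t).2⟩

/-! ### Block diagonal representations -/

section Block

variable {X Y H E : Type} [TopologicalSpace X] [CompactSpace X]
  [NormedAddCommGroup H] [InnerProductSpace ℂ H] [CompleteSpace H]
  [NormedAddCommGroup E] [InnerProductSpace ℂ E] [CompleteSpace E]

/-- The representation of `C(X, B(H))` on `⨁_{y ∈ Y} H` by the block diagonal operators with blocks
`F (φ y)`. -/
def blockDiag (φ : Y → X) : C(X, BddOp H) →⋆ₐ[ℂ] BddOp (lp (fun _ : Y => H) 2) where
  toFun F := lp.mapCLM 2 (fun y : Y => F (φ y)) (norm_nonneg F) fun y => F.norm_coe_le_norm (φ y)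
  map_one' := by ext; simp
  map_mul' f g := by ext; simp
  map_zero' := by ext; simp
  map_add' f g := by ext; simp
  commutes' r := by ext; simp [Algebra.algebraMap_eq_smul_one]
  map_star' f := by
    rw [ContinuousLinearMap.star_eq_adjoint, ContinuousLinearMap.eq_adjoint_iff]
    intro x y
    rw [lp.inner_eq_tsum, lp.inner_eq_tsum]
    refine tsum_congr fun l => ?_
    simp [ContinuousLinearMap.star_eq_adjoint, ContinuousLinearMap.adjoint_inner_left]

theorem blockDiag_apply (φ : Y → X) (F : C(X, BddOp H)) (x : lp (fun _ : Y => H) 2) (y : Y) :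
    blockDiag φ F x y = F (φ y) (x y) := by
  simp [blockDiag]

variable {V : Y → H →ₗᵢ[ℂ] E} (hV : OrthogonalFamily ℂ (fun _ : Y => H) V)

/-- The isometry `⨁_{y ∈ Y} H → E` given by an orthogonal family of isometries `H → E`. -/
def familyIsometry : lp (fun _ : Y => H) 2 →L[ℂ] E := hV.linearIsometry.toContinuousLinearMap

omit [CompleteSpace H] in
theorem familyIsometry_single [DecidableEq Y] (y : Y) (w : H) :
    familyIsometry hV (lp.single 2 y w) = V y w :=
  hV.linearIsometry_apply_single w

theorem adjoint_familyIsometry_comp_self :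
    (familyIsometry hV).adjoint ∘L familyIsometry hV = 1 :=
  (ContinuousLinearMap.inner_map_map_iff_adjoint_comp_self _).1 hV.linearIsometry.inner_map_map

/-- The block diagonal representation of `C(X, B(H))` on a Hilbert space `E` with an orthogonal
family of isometries `V y : H → E`; it vanishes on the orthogonal complement of their ranges. -/
def blockRep (φ : Y → X) : C(X, BddOp H) →⋆ₙₐ[ℂ] BddOp E where
  toFun F := familyIsometry hV ∘L blockDiag φ F ∘L (familyIsometry hV).adjoint
  map_smul' c F := by ext; simp
  map_zero' := by ext; simp
  map_add' F G := by ext; simp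
  map_mul' F G := by
    ext x
    have h := fun z => DFunLike.congr_fun (adjoint_familyIsometry_comp_self hV) z
    simp only [ContinuousLinearMap.comp_apply, one_apply_eq_self] at h
    simp [h]
  map_star' F := by
    simp only [map_star, ContinuousLinearMap.star_eq_adjoint, ContinuousLinearMap.adjoint_comp,
      ContinuousLinearMap.adjoint_adjoint, ContinuousLinearMap.comp_assoc]

theorem blockRep_apply_family (φ : Y → X) (F : C(X, BddOp H)) (y : Y) (w : H) :
    blockRep hV φ F (V y w) = V y (F (φ y) w) := by
  classical
  have h := DFunLike.congr_fun (adjoint_familyIsometry_comp_self hV) (lp.single 2 y w)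
  simp only [ContinuousLinearMap.comp_apply, one_apply_eq_self,
    familyIsometry_single] at h
  change familyIsometry hV (blockDiag φ F ((familyIsometry hV).adjoint (V y w))) = _
  rw [h, ← familyIsometry_single hV]
  congr 1
  ext z
  rw [blockDiag_apply]
  by_cases hz : z = y
  · subst hz; simp
  · simp [lp.single_apply, hz]

theorem blockRep_apply_of_orthogonal (φ : Y → X) (F : C(X, BddOp H)) {x : E}
    (hx : ∀ y w, inner ℂ (V y w) x = 0) : blockRep hV φ F x = 0 := by
  classical
  have h : (familyIsometry hV).adjoint x = 0 := by
    ext y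
    refine ext_inner_left ℂ fun w => ?_
    have := lp.inner_single_left (𝕜 := ℂ) y w ((familyIsometry hV).adjoint x)
    rw [← this, ContinuousLinearMap.adjoint_inner_right, familyIsometry_single, hx]
    simp
  change familyIsometry hV (blockDiag φ F ((familyIsometry hV).adjoint x)) = _
  rw [h, map_zero, map_zero]

/-- The operator determines every block `F (φ y)`, and a continuous `F` is determined on a dense
set. -/
theorem blockRep_injective {φ : Y → X} (hφ : DenseRange φ) :
    Function.Injective (blockRep hV φ) := by
  intro F G h
  refine DFunLike.coe_injective (hφ.equalizer F.continuous G.continuous ?_)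
  ext y w
  refine (V y).injective ?_
  simp only [Function.comp_apply]
  rw [← blockRep_apply_family hV φ, h, blockRep_apply_family]

theorem blockRep_isometry {φ : Y → X} (hφ : DenseRange φ) : Isometry (blockRep hV φ) :=
  NonUnitalStarAlgHom.isometry _ (blockRep_injective hV hφ)

theorem isClosed_map_compactSections {ι : Type} {V : Y → L2 ι →ₗᵢ[ℂ] E}
    (hV : OrthogonalFamily ℂ (fun _ : Y => L2 ι) V) {φ : Y → X} (hφ : DenseRange φ) :
    IsClosed (((compactSections X ι).map (blockRep hV φ) : NonUnitalStarSubalgebra ℂ (BddOp E)) :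
      Set (BddOp E)) := by
  rw [NonUnitalStarSubalgebra.coe_map]
  exact (blockRep_isometry hV hφ).isClosedEmbedding.isClosedMap _ isClosed_compactSections

/-- A closed subspace that contains the images of the functions `x ↦ f x • e_ij` contains the image
of `C(X, K)`. -/
theorem map_compactSections_subset {ι : Type} {V : Y → L2 ι →ₗᵢ[ℂ] E}
    (hV : OrthogonalFamily ℂ (fun _ : Y => L2 ι) V) {φ : Y → X}
    (hφ : DenseRange φ) {S : Submodule ℂ (BddOp E)} (hS : IsClosed (S : Set (BddOp E)))
    (h : ∀ (f : C(X, ℂ)) (i j : ι), blockRep hV φ (elemSection f (matrixUnit i j)) ∈ S) :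
    (((compactSections X ι).map (blockRep hV φ) : NonUnitalStarSubalgebra ℂ (BddOp E)) :
      Set (BddOp E)) ⊆ S := by
  rintro _ ⟨F, hF, rfl⟩
  have h1 : IsClosed (blockRep hV φ ⁻¹' (S : Set (BddOp E))) :=
    hS.preimage (blockRep_isometry hV hφ).continuous
  refine closure_minimal ?_ h1 (compactSections_subset_closure_span hF)
  have h2 : Submodule.span ℂ
      {F | ∃ (f : C(X, ℂ)) (i j : ι), F = elemSection f (matrixUnit i j)} ≤
      S.comap (LinearMapClass.linearMap (blockRep hV φ)) := by
    rw [Submodule.span_le]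
    rintro _ ⟨f, i, j, rfl⟩
    exact h f i j
  exact h2

end Block

/-! ### `C(X) ⊗ K` as the algebra of compact sections -/

section Tensor

variable {X : Type}

theorem ext_hilbertTensor {K E : Type} [NormedAddCommGroup K] [InnerProductSpace ℂ K]
    [NormedAddCommGroup E] [NormedSpace ℂ E] {A B : HilbertTensor (L2 X) K →L[ℂ] E}
    (h : ∀ (x : X) (w : K), A ((basisVec x ⊗ₜ[ℂ] w : L2 X ⊗[ℂ] K) : HilbertTensor (L2 X) K) =
      B ((basisVec x ⊗ₜ[ℂ] w : L2 X ⊗[ℂ] K) : HilbertTensor (L2 X) K)) : A = B := by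
  refine DFunLike.coe_injective
    (UniformSpace.Completion.ext A.continuous B.continuous fun z => ?_)
  induction z using TensorProduct.induction_on with
  | zero => rw [UniformSpace.Completion.coe_zero, map_zero, map_zero]
  | add z₁ z₂ h₁ h₂ => rw [UniformSpace.Completion.coe_add, map_add, map_add, h₁, h₂]
  | tmul v w =>
    let c : L2 X →L[ℂ] HilbertTensor (L2 X) K :=
      UniformSpace.Completion.toComplL ∘L (TensorProduct.mkL ℂ (L2 X) K).flip w
    exact DFunLike.congr_fun (ext_basisVec (S := A ∘L c) (T := B ∘L c) fun x => h x w) v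

/-- The isometry `w ↦ E_x ⊗ w`. -/
def tensorFamily (X K : Type) [NormedAddCommGroup K] [InnerProductSpace ℂ K] (x : X) :
    K →ₗᵢ[ℂ] HilbertTensor (L2 X) K where
  toLinearMap := UniformSpace.Completion.toComplₗᵢ.toLinearMap ∘ₗ
    TensorProduct.mk ℂ (L2 X) K (basisVec x)
  norm_map' w := by simp [norm_basisVec]

theorem tensorFamily_apply {K : Type} [NormedAddCommGroup K] [InnerProductSpace ℂ K] (x : X)
    (w : K) : tensorFamily X K x w =
      ((basisVec x ⊗ₜ[ℂ] w : L2 X ⊗[ℂ] K) : HilbertTensor (L2 X) K) := rfl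

theorem orthogonalFamily_tensorFamily (X K : Type) [NormedAddCommGroup K]
    [InnerProductSpace ℂ K] : OrthogonalFamily ℂ (fun _ : X => K) (tensorFamily X K) := by
  classical
  intro x y hxy v w
  simp only [tensorFamily_apply, UniformSpace.Completion.inner_coe, TensorProduct.inner_tmul,
    inner_basisVec_basisVec, if_neg hxy, zero_mul]

variable [TopologicalSpace X] [CompactSpace X]

theorem blockRep_tensorFamily_elemSection {ι : Type} (f : C(X, ℂ)) (T : BddOp (L2 ι)) :
    blockRep (orthogonalFamily_tensorFamily X (L2 ι)) id (elemSection f T) =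
      tensorOp (diagRep id f) T := by
  refine ext_hilbertTensor fun x w => ?_
  rw [← tensorFamily_apply, blockRep_apply_family, tensorFamily_apply, tensorFamily_apply,
    tensorOp_tmul, diagRep_basisVec, elemSection_apply, TensorProduct.smul_tmul]
  rfl

/-- Both sides are closed. The elementary sections `f • e_ij` have dense span on the left and go to
the elementary tensors `f ⊗ e_ij`; conversely every generator `f ⊗ T` is the image of a compact
section. -/
theorem map_compactSections_tensorFamily (ι : Type) :
    (compactSections X ι).map (blockRep (orthogonalFamily_tensorFamily X (L2 ι)) id) =
      spatialTensor (contAlg X) (compactOps (L2 ι)) := by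
  refine le_antisymm ?_ ?_
  · refine map_compactSections_subset _ denseRange_id
      (S := (spatialTensor (contAlg X) (compactOps (L2 ι))).toSubmodule)
      (NonUnitalStarSubalgebra.isClosed_topologicalClosure _) fun f i j => ?_
    refine NonUnitalStarSubalgebra.le_topologicalClosure _
      (NonUnitalStarAlgebra.subset_adjoin ℂ _ ?_)
    exact ⟨diagRep id f, ⟨f, rfl⟩, matrixUnit i j, isCompactOperator_matrixUnit i j,
      blockRep_tensorFamily_elemSection f _⟩
  · refine NonUnitalStarSubalgebra.topologicalClosure_minimal _ ?_
      (isClosed_map_compactSections _ denseRange_id)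
    refine NonUnitalStarAlgebra.adjoin_le ?_
    rintro _ ⟨_, ⟨f, rfl⟩, T, hT, rfl⟩
    exact ⟨elemSection f T, elemSection_mem f hT, blockRep_tensorFamily_elemSection f T⟩

end Tensor

/-! ### Functional calculus of a unitary on the circle -/

section Circle

theorem fourier_natCast (n : ℕ) : (fourier (n : ℤ) : C(UnitAddCircle, ℂ)) = fourier 1 ^ n := by
  induction n with
  | zero => ext x; simp
  | succ n ih =>
    ext x
    rw [pow_succ, ← ih, Nat.cast_succ, ContinuousMap.mul_apply, fourier_add]

theorem fourier_neg_eq_star (n : ℤ) :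
    (fourier (-n) : C(UnitAddCircle, ℂ)) = star (fourier n) := by
  ext x
  rw [fourier_neg]
  rfl

theorem fourier_add_eq_mul (m n : ℤ) :
    (fourier (m + n) : C(UnitAddCircle, ℂ)) = fourier m * fourier n := by
  ext x
  rw [fourier_add]
  rfl

/-- Density of trigonometric polynomials; it reduces closed linear conditions on `g` to monomials.
-/
theorem mem_of_forall_fourier_mem {S : Submodule ℂ C(UnitAddCircle, ℂ)}
    (hS : IsClosed (S : Set C(UnitAddCircle, ℂ))) (h : ∀ n : ℤ, fourier n ∈ S)
    (g : C(UnitAddCircle, ℂ)) : g ∈ S := by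
  have h1 : Submodule.span ℂ (Set.range (fourier : ℤ → C(UnitAddCircle, ℂ))) ≤ S :=
    Submodule.span_le.2 (by rintro _ ⟨n, rfl⟩; exact h n)
  have h2 := Submodule.topologicalClosure_minimal _ h1 hS
  rw [span_fourier_closure_eq_top] at h2
  exact h2 trivial

variable {A : Type} [CStarAlgebra A]

theorem map_mem_of_map_fourier_one_mem (γ : C(UnitAddCircle, ℂ) →⋆ₐ[ℂ] A) {S : StarSubalgebra ℂ A}
    (hS : IsClosed (S : Set A)) (h : γ (fourier 1) ∈ S) (g : C(UnitAddCircle, ℂ)) : γ g ∈ S := by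
  have hγ : Continuous γ := AddMonoidHomClass.continuous_of_bound γ 1 fun a => by
    simpa using NonUnitalStarAlgHom.norm_apply_le γ a
  have hn (n : ℕ) : γ (fourier (n : ℤ)) ∈ S := by
    rw [fourier_natCast, map_pow]; exact pow_mem h n
  refine mem_of_forall_fourier_mem
    (S := (Subalgebra.toSubmodule S.toSubalgebra).comap γ.toAlgHom.toLinearMap)
    (hS.preimage hγ) (fun n => ?_) g
  change γ (fourier n) ∈ S
  obtain ⟨m, rfl | rfl⟩ := n.eq_nat_or_neg
  · exact hn m
  · rw [fourier_neg_eq_star, map_star]; exact star_mem (hn m)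

variable {u : A} (hu : u ∈ unitary A)

/-- The inclusion of the spectrum of a unitary into the circle. -/
def spectrumToCircle : C(spectrum ℂ u, UnitAddCircle) where
  toFun x := (AddCircle.homeomorphCircle one_ne_zero).symm
    (⟨x, spectrum.subset_circle_of_unitary hu x.2⟩ : Circle)
  continuous_toFun := (Homeomorph.continuous _).comp (continuous_subtype_val.subtype_mk _)

theorem toCircle_spectrumToCircle (x : spectrum ℂ u) :
    ((AddCircle.toCircle (spectrumToCircle hu x) : Circle) : ℂ) = x := by
  rw [← AddCircle.homeomorphCircle_apply one_ne_zero]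
  exact congrArg Subtype.val ((AddCircle.homeomorphCircle one_ne_zero).apply_symm_apply _)

/-- The functional calculus `C(ℝ/ℤ) → A` of a unitary `u`, which sends `t ↦ exp (2 π i t)`
to `u`. -/
def circleCalculus : C(UnitAddCircle, ℂ) →⋆ₐ[ℂ] A :=
  (cfcHom (R := ℂ) (isStarNormal_of_mem_unitary hu)).comp
    ((spectrumToCircle hu).compStarAlgHom' ℂ ℂ)

theorem circleCalculus_fourier_one : circleCalculus hu (fourier 1) = u := by
  have h : (fourier 1 : C(UnitAddCircle, ℂ)).comp (spectrumToCircle hu) =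
      (ContinuousMap.id ℂ).restrict (spectrum ℂ u) := by
    ext x
    simp only [ContinuousMap.comp_apply, fourier_one, toCircle_spectrumToCircle]
    rfl
  change cfcHom (R := ℂ) (isStarNormal_of_mem_unitary hu) ((fourier 1).comp _) = u
  rw [h, cfcHom_id]

/-- When the spectrum is the full circle, `spectrumToCircle` is onto, so pulling back along it loses
nothing. -/
theorem circleCalculus_injective (h : Metric.sphere (0 : ℂ) 1 ⊆ spectrum ℂ u) :
    Function.Injective (circleCalculus hu) := by
  refine (cfcHom_injective _).comp fun f g hfg => ?_
  ext t
  have ht : ((AddCircle.toCircle t : Circle) : ℂ) ∈ spectrum ℂ u := h (AddCircle.toCircle t).2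
  have h1 : spectrumToCircle hu ⟨_, ht⟩ = t := by
    refine AddCircle.injective_toCircle one_ne_zero (Circle.ext ?_)
    rw [toCircle_spectrumToCircle]
  have h2 := DFunLike.congr_fun hfg ⟨_, ht⟩
  simpa [h1] using h2

end Circle

/-! ### The algebra generated by the bilateral shift -/

section Shift

theorem opv_mem_unitary : opv ∈ unitary (BddOp (L2 ℤ)) :=
  basisShift_mem_unitary _ ⟨add_left_injective 1, add_right_surjective 1⟩

/-- The unitary `E_l ↦ z ^ l E_l`. -/
def rotation (z : Circle) : BddOp (L2 ℤ) :=
  diagRep (fun l : ℤ => z ^ l) (⟨fun w => (w : ℂ), by fun_prop⟩ : C(Circle, ℂ))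

theorem rotation_basisVec (z : Circle) (l : ℤ) :
    rotation z (basisVec l) = ((z : ℂ) ^ l) • basisVec l := by
  rw [rotation, diagRep_basisVec]
  rfl

theorem rotation_mem_unitary (z : Circle) : rotation z ∈ unitary (BddOp (L2 ℤ)) := by
  refine Unitary.map_mem (diagRep _) (Unitary.mem_iff_self_mul_star.2 ?_)
  ext w
  change (w : ℂ) * starRingEnd ℂ w = 1
  simp [Complex.mul_conj]

theorem rotation_mul_opv (z : Circle) : rotation z * opv = (z : ℂ) • (opv * rotation z) := by
  refine ext_basisVec fun l => ?_
  simp only [mul_apply_eq_comp, smul_apply, opv, basisShift_basisVec,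
    rotation_basisVec, map_smul, smul_smul]
  rw [zpow_add_one₀ (Circle.coe_ne_zero z), mul_comm]

/-- Conjugation by the unitary `rotation z` multiplies `v` by `z`. -/
theorem spectrum_opv_smul (z : Circle) : spectrum ℂ ((z : ℂ) • opv) = spectrum ℂ opv := by
  have h := Unitary.spectrum_star_right_conjugate (R := ℂ) (a := opv)
    (U := ⟨rotation z, rotation_mem_unitary z⟩)
  rw [← h]
  change _ = spectrum ℂ (rotation z * opv * star (rotation z))
  rw [rotation_mul_opv, smul_mul_assoc, mul_assoc, (rotation_mem_unitary z).2, mul_one]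

/-- The spectrum is nonempty, lies in the circle and is invariant under rotation. -/
theorem sphere_subset_spectrum_opv : Metric.sphere (0 : ℂ) 1 ⊆ spectrum ℂ opv := by
  intro t ht
  have : Nontrivial (L2 ℤ) := ⟨basisVec 0, 0, fun h => by simpa [h] using norm_basisVec (0 : ℤ)⟩
  obtain ⟨w, hw⟩ := spectrum.nonempty opv
  have hw1 : ‖w‖ = 1 := spectrum.norm_eq_one_of_unitary opv_mem_unitary hw
  have ht1 : ‖t‖ = 1 := by simpa using ht
  have hw0 : w ≠ 0 := norm_pos_iff.1 (by rw [hw1]; exact one_pos)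
  let z : Circle := ⟨t / w, mem_sphere_zero_iff_norm.2 (by rw [norm_div, hw1, ht1, div_one])⟩
  rw [← spectrum_opv_smul z]
  have h := (spectrum.smul_mem_smul_iff (a := opv) (s := w) (r := Circle.toUnits z)).2 hw
  have h2 : Circle.toUnits z • w = t := by
    change t / w * w = t
    field_simp
  rwa [h2] at h

theorem opm_eq {s : ℕ} [Fact (2 ≤ s)] (f : C(SAdicInt s, ℂ)) :
    opm f = algebraMap ℂ (BddOp (L2 ℤ)) (f 0) := by
  refine ext_basisVec fun l => ?_
  rw [opm, diagRep_basisVec, Algebra.algebraMap_eq_smul_one]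
  rfl

variable (s : ℕ) [Fact (2 ≤ s)]

/-- The `m_f` are scalars, so only `v` matters; the range of the calculus is closed because a
faithful `*`-homomorphism is isometric. -/
theorem shiftAlg_eq_range :
    (shiftAlg s : Set (BddOp (L2 ℤ))) = Set.range (circleCalculus opv_mem_unitary) := by
  refine Set.Subset.antisymm ?_ ?_
  · have hcl : IsClosed ((circleCalculus opv_mem_unitary).range : Set (BddOp (L2 ℤ))) := by
      exact (NonUnitalStarAlgHom.isometry _
        (circleCalculus_injective _ sphere_subset_spectrum_opv)).isClosedEmbedding.isClosed_range
    have h : shiftAlg s ≤ (circleCalculus opv_mem_unitary).range := by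
      refine StarSubalgebra.topologicalClosure_minimal (StarAlgebra.adjoin_le ?_) hcl
      rintro _ (rfl | ⟨f, rfl⟩)
      · exact ⟨fourier 1, circleCalculus_fourier_one _⟩
      · rw [opm_eq]; exact algebraMap_mem _ _
    exact h
  · rintro _ ⟨g, rfl⟩
    refine map_mem_of_map_fourier_one_mem _ (StarSubalgebra.isClosed_topologicalClosure _) ?_ g
    rw [circleCalculus_fourier_one]
    exact StarSubalgebra.le_topologicalClosure _ (StarAlgebra.subset_adjoin ℂ _ (Or.inl rfl))

/-- The isomorphism `C(ℝ/ℤ) ≅ C*(v, m_f)`. -/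
def shiftEquiv : C(UnitAddCircle, ℂ) ≃⋆ₐ[ℂ] shiftAlg s :=
  StarAlgEquiv.ofBijective
    ((circleCalculus opv_mem_unitary).codRestrict (shiftAlg s)
      fun g => (shiftAlg_eq_range s).symm.subset ⟨g, rfl⟩)
    ⟨fun _ _ h => circleCalculus_injective opv_mem_unitary sphere_subset_spectrum_opv (congrArg Subtype.val h), by
      rintro ⟨T, hT⟩
      obtain ⟨g, hg⟩ := (shiftAlg_eq_range s).subset hT
      exact ⟨g, Subtype.ext hg⟩⟩

theorem shiftEquiv_apply (g : C(UnitAddCircle, ℂ)) :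
    (shiftEquiv s g : BddOp (L2 ℤ)) = circleCalculus opv_mem_unitary g := rfl

end Shift

/-! ### The positive linear section `g ↦ g(V)` -/

section Toeplitz

variable (s : ℕ) [Fact (2 ≤ s)]

/-- The unitary `E_q ↦ E_{s q}` on `ℓ²(ℚ)`, which dilates the `s`-adic shift. -/
def dilation : BddOp (L2 ℚ) :=
  basisShift (fun q : ℚ => (s : ℚ) * q) (mul_right_injective₀ (Nat.cast_ne_zero.mpr (NeZero.ne s)))

theorem dilation_mem_unitary : dilation s ∈ unitary (BddOp (L2 ℚ)) :=
  basisShift_mem_unitary _ ⟨mul_right_injective₀ (Nat.cast_ne_zero.mpr (NeZero.ne s)),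
    mul_left_surjective₀ (Nat.cast_ne_zero.mpr (NeZero.ne s))⟩

/-- For an injective map `φ : ι → κ`, the isometry `E_l ↦ E_{φ l}` from `ℓ²(ι)` to `ℓ²(κ)`. -/
def basisInclusion {ι κ : Type} (φ : ι → κ) (hφ : Function.Injective φ) : L2 ι →ₗᵢ[ℂ] L2 κ :=
  (orthonormal_basisVec.comp φ hφ).orthogonalFamily.linearIsometry

theorem basisInclusion_basisVec {ι κ : Type} (φ : ι → κ) (hφ : Function.Injective φ) (l : ι) :
    basisInclusion φ hφ (basisVec l) = basisVec (φ l) := by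
  classical
  have h : (basisVec l : L2 ι) = lp.single 2 l (1 : ℂ) := by
    simp only [basisVec]
  rw [basisInclusion, h, OrthogonalFamily.linearIsometry_apply_single]
  simp

/-- The inclusion `ℓ²(ℤ) → ℓ²(ℚ)`. -/
def ratInclusion : L2 ℤ →ₗᵢ[ℂ] L2 ℚ := basisInclusion (fun l : ℤ => (l : ℚ)) Int.cast_injective

theorem ratInclusion_basisVec (l : ℤ) : ratInclusion (basisVec l) = basisVec (l : ℚ) :=
  basisInclusion_basisVec _ _ l

theorem dilation_ratInclusion (x : L2 ℤ) :
    dilation s (ratInclusion x) = ratInclusion (opV s x) := by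
  refine DFunLike.congr_fun (ext_basisVec
    (S := dilation s ∘L ratInclusion.toContinuousLinearMap)
    (T := ratInclusion.toContinuousLinearMap ∘L opV s) fun l => ?_) x
  change dilation s (ratInclusion (basisVec l)) = ratInclusion (opV s (basisVec l))
  rw [ratInclusion_basisVec, dilation, basisShift_basisVec, opV, basisShift_basisVec,
    ratInclusion_basisVec]
  push_cast
  rfl

/-- The compression to `ℓ²(ℤ)` of the functional calculus of the unitary dilation of `V`. -/
def toeplitz : C(UnitAddCircle, ℂ) →ₗ[ℂ] BddOp (L2 ℤ) where
  toFun g := ratInclusion.toContinuousLinearMap.adjoint ∘L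
    circleCalculus (dilation_mem_unitary s) g ∘L ratInclusion.toContinuousLinearMap
  map_add' f g := by ext1 x; simp
  map_smul' c g := by ext1 x; simp

theorem toeplitz_apply (g : C(UnitAddCircle, ℂ)) (x : L2 ℤ) :
    toeplitz s g x = ratInclusion.toContinuousLinearMap.adjoint
      (circleCalculus (dilation_mem_unitary s) g (ratInclusion x)) := rfl

theorem norm_toeplitz_le (g : C(UnitAddCircle, ℂ)) : ‖toeplitz s g‖ ≤ ‖g‖ := by
  have h1 : ‖(ratInclusion.toContinuousLinearMap : L2 ℤ →L[ℂ] L2 ℚ)‖ ≤ 1 :=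
    ratInclusion.norm_toContinuousLinearMap_le
  have h2 : ‖(ratInclusion.toContinuousLinearMap : L2 ℤ →L[ℂ] L2 ℚ).adjoint‖ ≤ 1 := by
    rwa [LinearIsometryEquiv.norm_map]
  refine (ContinuousLinearMap.opNorm_comp_le _ _).trans ?_
  refine (mul_le_of_le_one_left (norm_nonneg _) h2).trans ?_
  refine (ContinuousLinearMap.opNorm_comp_le _ _).trans ?_
  refine (mul_le_of_le_one_right (norm_nonneg _) h1).trans ?_
  exact NonUnitalStarAlgHom.norm_apply_le _ g

theorem continuous_toeplitz : Continuous (toeplitz s) :=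
  AddMonoidHomClass.continuous_of_bound _ 1 fun g => by simpa using norm_toeplitz_le s g

theorem toeplitz_star (g : C(UnitAddCircle, ℂ)) : toeplitz s (star g) = star (toeplitz s g) := by
  change _ ∘L _ ∘L _ = ContinuousLinearMap.adjoint (_ ∘L _ ∘L _)
  rw [map_star, ContinuousLinearMap.adjoint_comp, ContinuousLinearMap.adjoint_comp,
    ContinuousLinearMap.adjoint_adjoint, ContinuousLinearMap.star_eq_adjoint,
    ContinuousLinearMap.comp_assoc]

theorem toeplitz_one : toeplitz s 1 = 1 := by
  ext1 x
  rw [toeplitz_apply, map_one]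
  exact DFunLike.congr_fun ((ContinuousLinearMap.inner_map_map_iff_adjoint_comp_self
    ratInclusion.toContinuousLinearMap).1 ratInclusion.inner_map_map) x

/-- The dilation leaves `ℓ²(ℤ)` invariant, so the compression is multiplicative when the right
factor is a nonnegative power. Negative powers would leave `ℓ²(ℤ)`. -/
theorem toeplitz_mul_fourier (g : C(UnitAddCircle, ℂ)) (n : ℕ) :
    toeplitz s (g * fourier n) = toeplitz s g * opV s ^ n := by
  have h1 (g : C(UnitAddCircle, ℂ)) : toeplitz s (g * fourier 1) = toeplitz s g * opV s := by
    ext1 x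
    rw [toeplitz_apply, map_mul, circleCalculus_fourier_one, mul_apply_eq_comp, mul_apply_eq_comp,
      toeplitz_apply, dilation_ratInclusion]
  induction n with
  | zero => rw [fourier_natCast, pow_zero, pow_zero, mul_one, mul_one]
  | succ n ih =>
    rw [Nat.cast_succ, fourier_add_eq_mul, ← mul_assoc, h1, ih, mul_assoc, pow_succ]

theorem toeplitz_fourier (n : ℕ) : toeplitz s (fourier n) = opV s ^ n := by
  rw [← one_mul (fourier (n : ℤ)), toeplitz_mul_fourier, toeplitz_one, one_mul]

theorem opV_mem : opV s ∈ HS s := (genV s).2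

theorem opM_mem {s : ℕ} [Fact (2 ≤ s)] (f : C(SAdicInt s, ℂ)) : opM f ∈ HS s := (genM f).2

theorem isClosed_HS : IsClosed (HS s : Set (BddOp (L2 ℤ))) :=
  StarSubalgebra.isClosed_topologicalClosure _

theorem toeplitz_mem_HS (g : C(UnitAddCircle, ℂ)) : toeplitz s g ∈ HS s := by
  refine mem_of_forall_fourier_mem
    (S := (Subalgebra.toSubmodule (HS s).toSubalgebra).comap (toeplitz s))
    ((isClosed_HS s).preimage (continuous_toeplitz s)) (fun n => ?_) g
  change toeplitz s (fourier n) ∈ HS s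
  obtain ⟨m, rfl | rfl⟩ := n.eq_nat_or_neg
  · rw [toeplitz_fourier]; exact pow_mem (opV_mem s) m
  · rw [fourier_neg_eq_star, toeplitz_star, toeplitz_fourier]
    exact star_mem (pow_mem (opV_mem s) m)

end Toeplitz

/-! ### The topology of the `s`-adic integers -/

section SAdic

variable {s : ℕ}

theorem sAdicInt_coord_eq_of_le {x y : SAdicInt s} {m n : ℕ} (h : m ≤ n) (hxy : x.1 n = y.1 n) :
    x.1 m = y.1 m := by
  rw [← x.2 m n h, ← y.2 m n h, hxy]

/-- A basic neighbourhood constrains finitely many residues, and the one of largest index determines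
the others. -/
theorem exists_forall_mem_of_coord_eq {y : SAdicInt s} {U : Set (SAdicInt s)} (hU : U ∈ 𝓝 y) :
    ∃ N : ℕ, ∀ x : SAdicInt s, x.1 N = y.1 N → x ∈ U := by
  rw [mem_nhds_subtype] at hU
  obtain ⟨W, hW, hWU⟩ := hU
  rw [nhds_pi, Filter.mem_pi] at hW
  obtain ⟨I, hI, t, ht, htW⟩ := hW
  obtain ⟨N, hN⟩ := hI.bddAbove
  refine ⟨N, fun x hx => hWU (htW fun m hm => ?_)⟩
  change x.1 m ∈ t m
  rw [sAdicInt_coord_eq_of_le (hN hm) hx]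
  exact mem_of_mem_nhds (ht m)

theorem natCast_pow_mul_coord (n : ℕ) (x : SAdicInt s) :
    (((s : SAdicInt s) ^ n * x : SAdicInt s)).1 n = 0 := by
  have h : ((s ^ n : ℕ) : ZMod (s ^ n)) = 0 := ZMod.natCast_self _
  push_cast at h
  change ((s : SAdicInt s).1 n) ^ n * x.1 n = 0
  have h2 : (s : SAdicInt s).1 n = (s : ZMod (s ^ n)) := rfl
  rw [h2, h, zero_mul]

/-- The uniformity in `x` is what later gives norm convergence of `f (s ^ n ·)` to `f 0`. -/
theorem eventually_pow_mul_mem {U : Set (SAdicInt s)} (hU : U ∈ 𝓝 0) :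
    ∀ᶠ n : ℕ in atTop, ∀ x : SAdicInt s, (s : SAdicInt s) ^ n * x ∈ U := by
  obtain ⟨N, hN⟩ := exists_forall_mem_of_coord_eq hU
  filter_upwards [eventually_ge_atTop N] with n hn x
  refine hN _ (sAdicInt_coord_eq_of_le hn ?_)
  rw [natCast_pow_mul_coord]
  rfl

theorem tendsto_natCast_pow : Tendsto (fun n : ℕ => (s : SAdicInt s) ^ n) atTop (𝓝 0) := by
  intro U hU
  refine mem_map.2 ?_
  filter_upwards [eventually_pow_mul_mem hU] with n hn
  simpa using hn 1

end SAdic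

/-! ### The homomorphism `π₀` -/

theorem isClosed_setOf_tendsto_zero {E F : Type*} [NormedAddCommGroup E] [NormedSpace ℂ E]
    [NormedAddCommGroup F] [NormedSpace ℂ F] (D : ℕ → E →ₗ[ℂ] F) (C : ℝ)
    (hD : ∀ n x, ‖D n x‖ ≤ C * ‖x‖) : IsClosed {x | Tendsto (fun n => D n x) atTop (𝓝 0)} := by
  refine isClosed_of_closure_subset fun x hx => ?_
  rw [Set.mem_ofPred_eq, Metric.tendsto_nhds]
  intro ε hε
  -- `C` has no assumed sign, so `|C| + 1` serves as a positive bound.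
  have hC : 0 < |C| + 1 := by positivity
  obtain ⟨y, hy, hxy⟩ := Metric.mem_closure_iff.1 hx (ε / 2 / (|C| + 1)) (by positivity)
  filter_upwards [Metric.tendsto_nhds.1 hy (ε / 2) (by positivity)] with n hn
  rw [dist_zero_right] at hn ⊢
  rw [dist_eq_norm, lt_div_iff₀ hC] at hxy
  have h1 : ‖D n x‖ ≤ ‖D n (x - y)‖ + ‖D n y‖ := by
    rw [map_sub]; exact norm_le_norm_sub_add _ _
  have h2 := hD n (x - y)
  have h3 : C * ‖x - y‖ ≤ ‖x - y‖ * (|C| + 1) := by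
    nlinarith [le_abs_self C, norm_nonneg (x - y)]
  linarith

section Limit

variable (s : ℕ) [Fact (2 ≤ s)]

/-- An injection `ℤ → ℤ` with value `s ^ j` at `j ≥ 0`. -/
def signedPow (j : ℤ) : ℤ := if 0 ≤ j then (s : ℤ) ^ j.toNat else -(s : ℤ) ^ (-j).toNat

omit [Fact (2 ≤ s)] in
variable {s} in
theorem signedPow_natCast (n : ℕ) : signedPow s n = (s : ℤ) ^ n := by simp [signedPow]

/-- Injectivity on all of `ℤ` makes `orbitIsometry` an isometry of `ℓ²(ℤ)`. The values at negative
indices are otherwise immaterial: for fixed `k`, `n + k ≥ 0` eventually. -/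
theorem signedPow_injective : Function.Injective (signedPow s) := by
  have h2 : (2 : ℤ) ≤ s := by exact_mod_cast (Fact.out : 2 ≤ s)
  have hpos (n : ℕ) : 0 < (s : ℤ) ^ n := by positivity
  have hinj : Function.Injective fun n : ℕ => (s : ℤ) ^ n :=
    pow_right_injective₀ (by omega) (by omega)
  intro i j hij
  unfold signedPow at hij
  split_ifs at hij with hi hj hj
  · have := hinj hij; omega
  · linarith [hpos i.toNat, hpos (-j).toNat]
  · linarith [hpos j.toNat, hpos (-i).toNat]
  · have := hinj (neg_injective hij); omega

/-- The isometry that sends `E_k` to `E_{s ^ (n + k)}` if `n + k ≥ 0`. -/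
def orbitIsometry (n : ℕ) : BddOp (L2 ℤ) :=
  basisShift (fun k : ℤ => signedPow s (n + k)) ((signedPow_injective s).comp (add_right_injective _))

theorem norm_orbitIsometry_apply (n : ℕ) (x : L2 ℤ) : ‖orbitIsometry s n x‖ = ‖x‖ :=
  basisShift_isometry _ _ x

/-- The defect of `W` intertwining `T` and `g(v)`, with `W` the isometry of
`orbitIsometry`. -/
def orbitDefect (n : ℕ) (x : L2 ℤ) : BddOp (L2 ℤ) × C(UnitAddCircle, ℂ) →ₗ[ℂ] L2 ℤ where
  toFun p := p.1 (orbitIsometry s n x) -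
    orbitIsometry s n (circleCalculus opv_mem_unitary p.2 x)
  map_add' p q := by simp; abel
  map_smul' c p := by simp [smul_sub]

theorem orbitDefect_apply (n : ℕ) (x : L2 ℤ) (p : BddOp (L2 ℤ) × C(UnitAddCircle, ℂ)) :
    orbitDefect s n x p = p.1 (orbitIsometry s n x) -
      orbitIsometry s n (circleCalculus opv_mem_unitary p.2 x) := rfl

theorem norm_orbitDefect_le (n : ℕ) (x : L2 ℤ) (p : BddOp (L2 ℤ) × C(UnitAddCircle, ℂ)) :
    ‖orbitDefect s n x p‖ ≤ 2 * ‖p‖ * ‖x‖ := by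
  rw [orbitDefect_apply]
  refine (norm_sub_le _ _).trans ?_
  have h1 : ‖p.1 (orbitIsometry s n x)‖ ≤ ‖p‖ * ‖x‖ := by
    refine (p.1.le_opNorm _).trans ?_
    rw [norm_orbitIsometry_apply]
    gcongr
    exact norm_fst_le p
  have h2 : ‖orbitIsometry s n (circleCalculus opv_mem_unitary p.2 x)‖ ≤ ‖p‖ * ‖x‖ := by
    rw [norm_orbitIsometry_apply]
    refine (ContinuousLinearMap.le_opNorm _ _).trans ?_
    gcongr
    exact (NonUnitalStarAlgHom.norm_apply_le _ _).trans (norm_snd_le p)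
  linarith

/-- A Leibniz-type rule, by inserting `p.1 W (q.2(v) x)`; it makes `limitGraph` closed under
products. -/
theorem orbitDefect_mul (n : ℕ) (x : L2 ℤ) (p q : BddOp (L2 ℤ) × C(UnitAddCircle, ℂ)) :
    orbitDefect s n x (p * q) = p.1 (orbitDefect s n x q) +
      orbitDefect s n (circleCalculus opv_mem_unitary q.2 x) p := by
  simp [orbitDefect_apply]

theorem tendsto_orbitDefect_of_basisVec {p : BddOp (L2 ℤ) × C(UnitAddCircle, ℂ)}
    (h : ∀ k : ℤ, Tendsto (fun n => orbitDefect s n (basisVec k) p) atTop (𝓝 0)) (x : L2 ℤ) :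
    Tendsto (fun n => orbitDefect s n x p) atTop (𝓝 0) := by
  let D (n : ℕ) : L2 ℤ →ₗ[ℂ] L2 ℤ :=
    { toFun := fun x => orbitDefect s n x p
      map_add' := fun x y => by simp [orbitDefect_apply]; abel
      map_smul' := fun c x => by simp [orbitDefect_apply, smul_sub] }
  have hcl := isClosed_setOf_tendsto_zero D (2 * ‖p‖) fun n x => norm_orbitDefect_le s n x p
  let S : Submodule ℂ (L2 ℤ) :=
    { carrier := {x | Tendsto (fun n => D n x) atTop (𝓝 0)}
      add_mem' := fun {x y} hx hy => by
        simpa only [Set.mem_ofPred_eq, map_add, add_zero] using Tendsto.add hx hy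
      zero_mem' := by simp
      smul_mem' := fun c x hx => by
        simpa only [Set.mem_ofPred_eq, map_smul, smul_zero] using Tendsto.const_smul hx c }
  have h1 : Submodule.span ℂ (Set.range (basisVec : ℤ → L2 ℤ)) ≤ S :=
    Submodule.span_le.2 (by rintro _ ⟨k, rfl⟩; exact h k)
  exact closure_minimal h1 hcl (dense_span_basisVec x)

/-- The graph of `π₀`: the pairs `(T, g)` such that `T` and `g(v)`, and their adjoints, are
asymptotically intertwined along the orbit of `1` under multiplication by `s`. -/
def limitGraph : StarSubalgebra ℂ (BddOp (L2 ℤ) × C(UnitAddCircle, ℂ)) where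
  carrier := {p | ∀ x, Tendsto (fun n => orbitDefect s n x p) atTop (𝓝 0) ∧
    Tendsto (fun n => orbitDefect s n x (star p)) atTop (𝓝 0)}
  add_mem' {p q} hp hq x := by
    simp only [map_add, star_add]
    exact ⟨by simpa using (hp x).1.add (hq x).1, by simpa using (hp x).2.add (hq x).2⟩
  mul_mem' {p q} hp hq x := by
    simp only [orbitDefect_mul, star_mul]
    refine ⟨?_, ?_⟩
    · simpa using ((p.1.continuous.tendsto 0).comp (hq x).1).add (hp _).1
    · simpa using (((star q).1.continuous.tendsto 0).comp (hp x).2).add (hq _).2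
  algebraMap_mem' c x := by
    have h (c : ℂ) : Tendsto (fun n => orbitDefect s n x (algebraMap ℂ _ c)) atTop (𝓝 0) := by
      simp [orbitDefect_apply, Algebra.algebraMap_eq_smul_one]
    refine ⟨h c, ?_⟩
    rw [← algebraMap_star_comm]
    exact h _
  star_mem' {p} hp x := by
    rw [star_star]
    exact (hp x).symm

theorem isClosed_limitGraph :
    IsClosed (limitGraph s : Set (BddOp (L2 ℤ) × C(UnitAddCircle, ℂ))) := by
  have h (x : L2 ℤ) : IsClosed {p : BddOp (L2 ℤ) × C(UnitAddCircle, ℂ) |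
      Tendsto (fun n => orbitDefect s n x p) atTop (𝓝 0)} :=
    isClosed_setOf_tendsto_zero (fun n => orbitDefect s n x) (2 * ‖x‖) fun n p => by
      have := norm_orbitDefect_le s n x p
      linarith
  have h2 : (limitGraph s : Set (BddOp (L2 ℤ) × C(UnitAddCircle, ℂ))) =
      ⋂ x, ({p | Tendsto (fun n => orbitDefect s n x p) atTop (𝓝 0)} ∩
        star ⁻¹' {p | Tendsto (fun n => orbitDefect s n x p) atTop (𝓝 0)}) := by
    ext p
    rw [Set.mem_iInter]
    rfl
  rw [h2]
  exact isClosed_iInter fun x => (h x).inter ((h x).preimage continuous_star)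

/-- The defect of `(0, g)` at `x` has norm `‖g(v) x‖` for every `n`, so its convergence to zero
forces `g(v) = 0`. -/
theorem eq_zero_of_mem_limitGraph {g : C(UnitAddCircle, ℂ)} (h : (0, g) ∈ limitGraph s) :
    g = 0 := by
  refine circleCalculus_injective opv_mem_unitary sphere_subset_spectrum_opv ?_
  rw [map_zero]
  ext1 x
  have h1 := (h x).1.norm
  simp only [orbitDefect_apply, zero_apply, zero_sub, norm_neg, norm_orbitIsometry_apply,
    norm_zero] at h1
  exact norm_eq_zero.1 (tendsto_nhds_unique tendsto_const_nhds h1)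

theorem limitGraph_unique {T : BddOp (L2 ℤ)} {g g' : C(UnitAddCircle, ℂ)}
    (h : (T, g) ∈ limitGraph s) (h' : (T, g') ∈ limitGraph s) : g = g' := by
  have := sub_mem h h'
  rw [Prod.mk_sub_mk, sub_self] at this
  exact sub_eq_zero.1 (eq_zero_of_mem_limitGraph s this)

theorem mem_limitGraph_opV : (opV s, fourier 1) ∈ limitGraph s := by
  intro x
  refine ⟨tendsto_orbitDefect_of_basisVec s (fun k => ?_) x,
    tendsto_orbitDefect_of_basisVec s (fun k => ?_) x⟩
  · refine tendsto_const_nhds.congr' ?_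
    filter_upwards [eventually_ge_atTop k.natAbs] with n hn
    obtain ⟨m, hm⟩ : ∃ m : ℕ, (n : ℤ) + k = m := ⟨((n : ℤ) + k).toNat, by omega⟩
    rw [orbitDefect_apply, circleCalculus_fourier_one, opv, opV, orbitIsometry]
    simp only [basisShift_basisVec]
    rw [← add_assoc, hm, ← Nat.cast_succ, signedPow_natCast, signedPow_natCast, pow_succ',
      sub_self]
  · refine tendsto_const_nhds.congr' ?_
    -- The extra `1` ensures `n + k ≥ 1`, so that `s ^ (n + k)` is a multiple of `s` and `V*` does
    -- not kill its basis vector.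
    filter_upwards [eventually_ge_atTop (k.natAbs + 1)] with n hn
    obtain ⟨m, hm⟩ : ∃ m : ℕ, (n : ℤ) + k = (m + 1 : ℕ) := ⟨((n : ℤ) + k - 1).toNat, by omega⟩
    rw [orbitDefect_apply, Prod.fst_star, Prod.snd_star, map_star, circleCalculus_fourier_one]
    have h1 : star opv (basisVec k) = basisVec (k - 1) := by
      have := star_basisShift_basisVec (fun l : ℤ => l + 1) (add_left_injective 1) (k - 1)
      rwa [sub_add_cancel] at this
    have h2 : star (opV s) (basisVec ((s : ℤ) ^ (m + 1))) = basisVec ((s : ℤ) ^ m) := by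
      rw [pow_succ']
      exact star_basisShift_basisVec (fun l : ℤ => (s : ℤ) * l) _ _
    have h3 : (n : ℤ) + (k - 1) = m := by push_cast at hm; omega
    rw [h1, orbitIsometry, basisShift_basisVec, basisShift_basisVec, hm, h3, signedPow_natCast,
      signedPow_natCast, h2, sub_self]

variable {s}

/-- On `E_k` the defect has norm `|f (s ^ (n + k)) - f 0|` for large `n`, and `s ^ (n + k) → 0` in
`ℤ_s`. -/
theorem mem_limitGraph_opM (f : C(SAdicInt s, ℂ)) :
    (opM f, algebraMap ℂ _ (f 0)) ∈ limitGraph s := by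
  have h (f : C(SAdicInt s, ℂ)) (x : L2 ℤ) :
      Tendsto (fun n => orbitDefect s n x (opM f, algebraMap ℂ _ (f 0))) atTop (𝓝 0) := by
    refine tendsto_orbitDefect_of_basisVec s (fun k => ?_) x
    have h1 : Tendsto (fun n : ℕ => f (((signedPow s (n + k) : ℤ) : SAdicInt s))) atTop
        (𝓝 (f 0)) := by
      refine (f.continuous.tendsto 0).comp ?_
      have h2 : Tendsto (fun n : ℕ => ((n : ℤ) + k).toNat) atTop atTop := by
        refine tendsto_atTop.2 fun b => ?_
        filter_upwards [eventually_ge_atTop (b + k.natAbs)] with n hn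
        omega
      refine (tendsto_natCast_pow.comp h2).congr' ?_
      filter_upwards [eventually_ge_atTop k.natAbs] with n hn
      rw [signedPow, if_pos (by omega)]
      simp
    rw [tendsto_zero_iff_norm_tendsto_zero]
    have h3 := (h1.sub_const (f 0)).norm
    rw [sub_self, norm_zero] at h3
    refine h3.congr fun n => ?_
    rw [orbitDefect_apply, Algebra.algebraMap_eq_smul_one, map_smul, map_one, orbitIsometry,
      basisShift_basisVec, opM, diagRep_basisVec, smul_apply, one_apply_eq_self, map_smul,
      basisShift_basisVec, ← sub_smul, norm_smul, norm_basisVec, mul_one]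
  intro x
  refine ⟨h f x, ?_⟩
  have h1 : star ((opM f, algebraMap ℂ C(UnitAddCircle, ℂ) (f 0)) :
      BddOp (L2 ℤ) × C(UnitAddCircle, ℂ)) = (opM (star f), algebraMap ℂ _ ((star f) 0)) := by
    rw [opM, opM, map_star]
    exact Prod.ext rfl (algebraMap_star_comm _).symm
  rw [h1]
  exact h _ x

/-- A closed `*`-subalgebra of the graph that contains the generators meets every fibre over
`HS(s)`. -/
theorem exists_mem_of_le_limitGraph {G : StarSubalgebra ℂ (BddOp (L2 ℤ) × C(UnitAddCircle, ℂ))}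
    (hG : G ≤ limitGraph s) (hcl : IsClosed (G : Set (BddOp (L2 ℤ) × C(UnitAddCircle, ℂ))))
    (hV : (opV s, fourier 1) ∈ G)
    (hM : ∀ f : C(SAdicInt s, ℂ), (opM f, algebraMap ℂ _ (f 0)) ∈ G)
    {T : BddOp (L2 ℤ)} (hT : T ∈ HS s) : ∃ g, (T, g) ∈ G := by
  have : CompleteSpace G := hcl.completeSpace_coe
  let p : G →⋆ₐ[ℂ] BddOp (L2 ℤ) :=
    (StarAlgHom.fst ℂ (BddOp (L2 ℤ)) C(UnitAddCircle, ℂ)).comp G.subtype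
  have hp : Function.Injective p := by
    rintro ⟨⟨T, g⟩, h⟩ ⟨⟨T', g'⟩, h'⟩ (hTT : T = T')
    subst hTT
    rw [Subtype.mk.injEq, limitGraph_unique s (hG h) (hG h')]
  -- Injectivity makes the projection isometric on the C*-algebra `G`, so its range is closed and
  -- absorbs the closure defining `HS(s)`.
  have hrange : IsClosed (p.range : Set (BddOp (L2 ℤ))) :=
    (NonUnitalStarAlgHom.isometry p hp).isClosedEmbedding.isClosed_range
  have hle : HS s ≤ p.range := by
    refine StarSubalgebra.topologicalClosure_minimal (StarAlgebra.adjoin_le ?_) hrange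
    rintro _ (rfl | ⟨f, rfl⟩)
    · exact ⟨⟨_, hV⟩, rfl⟩
    · exact ⟨⟨_, hM f⟩, rfl⟩
  obtain ⟨⟨⟨T', g⟩, h⟩, rfl⟩ := hle hT
  exact ⟨g, h⟩

theorem exists_mem_limitGraph {T : BddOp (L2 ℤ)} (hT : T ∈ HS s) :
    ∃ g, (T, g) ∈ limitGraph s :=
  exists_mem_of_le_limitGraph le_rfl (isClosed_limitGraph s) (mem_limitGraph_opV s)
    mem_limitGraph_opM hT

variable (s)

/-- The underlying function of `piZero`. -/
def piZeroFun (T : HS s) : C(UnitAddCircle, ℂ) := (exists_mem_limitGraph T.2).choose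

theorem mem_limitGraph_piZeroFun (T : HS s) : ((T : BddOp (L2 ℤ)), piZeroFun s T) ∈ limitGraph s :=
  (exists_mem_limitGraph T.2).choose_spec

variable {s} in
theorem piZeroFun_eq {T : HS s} {p : BddOp (L2 ℤ) × C(UnitAddCircle, ℂ)} (h : p ∈ limitGraph s)
    (hp : p.1 = T) : piZeroFun s T = p.2 :=
  limitGraph_unique s (mem_limitGraph_piZeroFun s T) (hp ▸ h)

/-- The homomorphism `π₀ : HS(s) → C(ℝ/ℤ)`. -/
def piZero : HS s →⋆ₐ[ℂ] C(UnitAddCircle, ℂ) where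
  toFun := piZeroFun s
  map_one' := piZeroFun_eq (one_mem (limitGraph s)) rfl
  map_mul' S T := piZeroFun_eq
    (mul_mem (mem_limitGraph_piZeroFun s S) (mem_limitGraph_piZeroFun s T)) rfl
  map_zero' := piZeroFun_eq (zero_mem (limitGraph s)) rfl
  map_add' S T := piZeroFun_eq
    (add_mem (mem_limitGraph_piZeroFun s S) (mem_limitGraph_piZeroFun s T)) rfl
  commutes' c := piZeroFun_eq (algebraMap_mem (limitGraph s) c) rfl
  map_star' T := piZeroFun_eq (star_mem (mem_limitGraph_piZeroFun s T)) rfl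

theorem piZero_genV : piZero s (genV s) = fourier 1 :=
  piZeroFun_eq (mem_limitGraph_opV s) rfl

variable {s} in
theorem piZero_genM (f : C(SAdicInt s, ℂ)) : piZero s (genM f) = algebraMap ℂ _ (f 0) :=
  piZeroFun_eq (mem_limitGraph_opM f) rfl

/-- A `*`-homomorphism from `HS(s)` is determined by its values on `V` and the `M_f`. -/
theorem ext_HS {B : Type} [CStarAlgebra B] {π π' : HS s →⋆ₐ[ℂ] B}
    (hV : π (genV s) = π' (genV s)) (hM : ∀ f, π (genM f) = π' (genM f)) : π = π' := by
  have : IsClosed (HS s : Set (BddOp (L2 ℤ))) := isClosed_HS s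
  have hc (π : HS s →⋆ₐ[ℂ] B) : Continuous π :=
    AddMonoidHomClass.continuous_of_bound π 1 fun a => by
      simpa using NonUnitalStarAlgHom.norm_apply_le π a
  refine StarAlgHom.ext_topologicalClosure (hc π) (hc π') (StarAlgHom.ext fun a => ?_)
  induction a using StarAlgebra.adjoin_induction_subtype with
  | mem x h =>
    obtain rfl | ⟨f, rfl⟩ := h
    · exact hV
    · exact hM f
  | algebraMap r => simp only [AlgHomClass.commutes]
  | add x y hx hy => rw [map_add, map_add, hx, hy]
  | mul x y hx hy => rw [map_mul, map_mul, hx, hy]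
  | star x hx => rw [map_star, map_star, hx]

end Limit

/-! ### The ideal generated by the functions on the unit sphere -/

section Ideal

variable {s : ℕ}

theorem intCast_mem_unitSphere (l : ℤ) : (l : SAdicInt s) ∈ UnitSphere s ↔ ¬ (s : ℤ) ∣ l := by
  have h : (l : SAdicInt s).1 1 = (l : ZMod (s ^ 1)) := rfl
  change (l : SAdicInt s).1 1 ≠ 0 ↔ _
  rw [h, Ne, ZMod.intCast_zmod_eq_zero_iff_dvd, pow_one]

theorem isClopen_unitSphere : IsClopen (UnitSphere s) := by
  refine ⟨isClosed_unitSphere s, ?_⟩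
  have h : Continuous fun x : SAdicInt s => x.1 1 :=
    (continuous_apply 1).comp continuous_subtype_val
  exact (isOpen_discrete ({0}ᶜ : Set (ZMod (s ^ 1)))).preimage h

/-- The function `x ↦ f (s ^ n x)`. -/
def scale (n : ℕ) (f : C(SAdicInt s, ℂ)) : C(SAdicInt s, ℂ) :=
  f.comp ⟨fun x => (s : SAdicInt s) ^ n * x, by fun_prop⟩

theorem scale_apply (n : ℕ) (f : C(SAdicInt s, ℂ)) (x : SAdicInt s) :
    scale n f x = f ((s : SAdicInt s) ^ n * x) := rfl

theorem scale_scale_one (n : ℕ) (f : C(SAdicInt s, ℂ)) :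
    scale 1 (scale n f) = scale (n + 1) f := by
  ext x
  rw [scale_apply, scale_apply, scale_apply, pow_one, pow_succ, mul_assoc]

/-- The characteristic function of the unit sphere. -/
def sphereIndicator (s : ℕ) : C(SAdicInt s, ℂ) where
  toFun := (UnitSphere s).indicator 1
  continuous_toFun := continuous_one.indicator (by simp [isClopen_unitSphere.frontier_eq])

theorem sphereIndicator_of_mem {x : SAdicInt s} (hx : x ∈ UnitSphere s) :
    sphereIndicator s x = 1 := Set.indicator_of_mem hx _

theorem sphereIndicator_of_notMem {x : SAdicInt s} (hx : x ∉ UnitSphere s) :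
    sphereIndicator s x = 0 := Set.indicator_of_notMem hx _

variable [Fact (2 ≤ s)]

theorem opV_basisVec (l : ℤ) : opV s (basisVec l) = basisVec ((s : ℤ) * l) :=
  basisShift_basisVec _ _ l

theorem star_opV_mul_opV : star (opV s) * opV s = 1 := star_basisShift_mul_self _ _

theorem star_opV_basisVec_mul (l : ℤ) : star (opV s) (basisVec ((s : ℤ) * l)) = basisVec l :=
  star_basisShift_basisVec (fun l : ℤ => (s : ℤ) * l) _ l

theorem star_opV_basisVec_of_not_dvd {l : ℤ} (hl : ¬ (s : ℤ) ∣ l) :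
    star (opV s) (basisVec l) = 0 :=
  star_basisShift_basisVec_of_notMem _ _ l fun ⟨k, hk⟩ => hl ⟨k, hk.symm⟩

theorem opM_basisVec (f : C(SAdicInt s, ℂ)) (l : ℤ) :
    opM f (basisVec l) = f (l : SAdicInt s) • basisVec l := diagRep_basisVec _ f l

theorem opM_mul (f g : C(SAdicInt s, ℂ)) : opM (f * g) = opM f * opM g := map_mul (diagRep _) f g

theorem star_opM (f : C(SAdicInt s, ℂ)) : star (opM f) = opM (star f) :=
  (map_star (diagRep _) f).symm

theorem norm_opM_le (f : C(SAdicInt s, ℂ)) : ‖opM f‖ ≤ ‖f‖ :=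
  NonUnitalStarAlgHom.norm_apply_le (diagRep _) f

theorem opM_sub_algebraMap (f : C(SAdicInt s, ℂ)) (c : ℂ) :
    opM (f - algebraMap ℂ _ c) = opM f - algebraMap ℂ _ c := by
  rw [opM, map_sub, AlgHomClass.commutes, opM]

theorem opM_mul_opV (f : C(SAdicInt s, ℂ)) : opM f * opV s = opV s * opM (scale 1 f) := by
  refine ext_basisVec fun l => ?_
  simp only [mul_apply_eq_comp, opV_basisVec, opM_basisVec, map_smul, scale_apply]
  simp

theorem opM_mul_opV_pow (f : C(SAdicInt s, ℂ)) (n : ℕ) :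
    opM f * opV s ^ n = opV s ^ n * opM (scale n f) := by
  induction n with
  | zero =>
    have : scale 0 f = f := by ext x; rw [scale_apply, pow_zero, one_mul]
    rw [this, pow_zero, mul_one, one_mul]
  | succ n ih =>
    rw [pow_succ, ← mul_assoc, ih, mul_assoc, opM_mul_opV, ← mul_assoc, scale_scale_one]

theorem one_sub_opV_mul_star_opV : 1 - opV s * star (opV s) = opM (sphereIndicator s) := by
  refine ext_basisVec fun l => ?_
  rw [opM_basisVec, sub_apply, mul_apply_eq_comp, one_apply_eq_self]
  by_cases hl : (s : ℤ) ∣ l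
  · obtain ⟨k, rfl⟩ := hl
    rw [star_opV_basisVec_mul, opV_basisVec, sub_self, sphereIndicator_of_notMem, zero_smul]
    rw [intCast_mem_unitSphere, not_not]
    exact dvd_mul_right _ _
  · rw [star_opV_basisVec_of_not_dvd hl, map_zero, sub_zero, sphereIndicator_of_mem, one_smul]
    rwa [intCast_mem_unitSphere]

/-- `M_f` lives on the `E_l` with `s ∤ l`, which are orthogonal to the range of `V`. -/
theorem star_opV_mul_opM {f : C(SAdicInt s, ℂ)} (hf : ∀ x ∉ UnitSphere s, f x = 0) :
    star (opV s) * opM f = 0 := by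
  refine ext_basisVec fun l => ?_
  rw [mul_apply_eq_comp, opM_basisVec, map_smul, zero_apply]
  by_cases hl : (s : ℤ) ∣ l
  · rw [hf _ (by rwa [intCast_mem_unitSphere, not_not]), zero_smul]
  · rw [star_opV_basisVec_of_not_dvd hl, smul_zero]

/-- The operators `V ^ i M_f V* ^ j` with `f` supported on the unit sphere. -/
def sphereMonomials (s : ℕ) [Fact (2 ≤ s)] : Set (BddOp (L2 ℤ)) :=
  {T | ∃ (i j : ℕ) (f : C(SAdicInt s, ℂ)), (∀ x ∉ UnitSphere s, f x = 0) ∧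
    T = opV s ^ i * opM f * star (opV s) ^ j}

/-- The closed span of the operators `V ^ i M_f V* ^ j` with `f` supported on the unit sphere. -/
def sphereIdeal (s : ℕ) [Fact (2 ≤ s)] : Submodule ℂ (BddOp (L2 ℤ)) :=
  (Submodule.span ℂ (sphereMonomials s)).topologicalClosure

theorem isClosed_sphereIdeal : IsClosed (sphereIdeal s : Set (BddOp (L2 ℤ))) :=
  Submodule.isClosed_topologicalClosure _

theorem monomial_mem_sphereIdeal (i j : ℕ) {f : C(SAdicInt s, ℂ)}
    (hf : ∀ x ∉ UnitSphere s, f x = 0) :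
    opV s ^ i * opM f * star (opV s) ^ j ∈ sphereIdeal s :=
  Submodule.le_topologicalClosure _ (Submodule.subset_span ⟨i, j, f, hf, rfl⟩)

theorem sphereIdeal_le {S : Submodule ℂ (BddOp (L2 ℤ))} (hS : IsClosed (S : Set (BddOp (L2 ℤ))))
    (h : sphereMonomials s ⊆ S) : sphereIdeal s ≤ S :=
  Submodule.topologicalClosure_minimal _ (Submodule.span_le.2 h) hS

theorem mul_mem_sphereIdeal_of_monomial {T : BddOp (L2 ℤ)}
    (h : ∀ K ∈ sphereMonomials s, T * K ∈ sphereIdeal s) {K : BddOp (L2 ℤ)}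
    (hK : K ∈ sphereIdeal s) : T * K ∈ sphereIdeal s :=
  sphereIdeal_le (S := (sphereIdeal s).comap (LinearMap.mulLeft ℂ T))
    (isClosed_sphereIdeal.preimage (continuous_const_mul T)) h hK

theorem star_mem_sphereIdeal {K : BddOp (L2 ℤ)} (hK : K ∈ sphereIdeal s) :
    star K ∈ sphereIdeal s := by
  let S : Submodule ℂ (BddOp (L2 ℤ)) :=
    { carrier := {K | star K ∈ sphereIdeal s}
      add_mem' := fun {a b} ha hb => by
        rw [Set.mem_ofPred_eq, star_add]; exact add_mem ha hb
      zero_mem' := by rw [Set.mem_ofPred_eq, star_zero]; exact zero_mem _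
      smul_mem' := fun c a ha => by
        rw [Set.mem_ofPred_eq, star_smul]; exact Submodule.smul_mem _ _ ha }
  refine sphereIdeal_le (S := S) (isClosed_sphereIdeal.preimage continuous_star) ?_ hK
  rintro _ ⟨i, j, f, hf, rfl⟩
  change star _ ∈ sphereIdeal s
  rw [star_mul, star_mul, star_pow, star_pow, star_star, star_opM, ← mul_assoc]
  exact monomial_mem_sphereIdeal j i fun x hx => by
    rw [ContinuousMap.star_apply, hf x hx, star_zero]

theorem opV_mul_mem_sphereIdeal {K : BddOp (L2 ℤ)} (hK : K ∈ sphereIdeal s) :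
    opV s * K ∈ sphereIdeal s := by
  refine mul_mem_sphereIdeal_of_monomial ?_ hK
  rintro _ ⟨i, j, f, hf, rfl⟩
  rw [← mul_assoc, ← mul_assoc, ← pow_succ']
  exact monomial_mem_sphereIdeal _ _ hf

theorem star_opV_mul_mem_sphereIdeal {K : BddOp (L2 ℤ)} (hK : K ∈ sphereIdeal s) :
    star (opV s) * K ∈ sphereIdeal s := by
  refine mul_mem_sphereIdeal_of_monomial ?_ hK
  rintro _ ⟨i, j, f, hf, rfl⟩
  cases i with
  | zero => rw [pow_zero, one_mul, ← mul_assoc, star_opV_mul_opM hf, zero_mul]; exact zero_mem _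
  | succ i =>
    rw [pow_succ', ← mul_assoc, ← mul_assoc, ← mul_assoc, star_opV_mul_opV, one_mul]
    exact monomial_mem_sphereIdeal _ _ hf

theorem opM_mul_mem_sphereIdeal (g : C(SAdicInt s, ℂ)) {K : BddOp (L2 ℤ)}
    (hK : K ∈ sphereIdeal s) : opM g * K ∈ sphereIdeal s := by
  refine mul_mem_sphereIdeal_of_monomial ?_ hK
  rintro _ ⟨i, j, f, hf, rfl⟩
  rw [← mul_assoc, ← mul_assoc, opM_mul_opV_pow, mul_assoc (opV s ^ i), ← opM_mul]
  exact monomial_mem_sphereIdeal _ _ fun x hx => by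
    rw [ContinuousMap.mul_apply, hf x hx, mul_zero]

/-- The operators that, together with their adjoints, multiply the ideal into itself from the left
form a closed `*`-algebra, so the generators suffice. -/
theorem mul_mem_sphereIdeal {T K : BddOp (L2 ℤ)} (hT : T ∈ HS s) (hK : K ∈ sphereIdeal s) :
    T * K ∈ sphereIdeal s := by
  let L : StarSubalgebra ℂ (BddOp (L2 ℤ)) :=
    { carrier := {T | ∀ K ∈ sphereIdeal s, T * K ∈ sphereIdeal s ∧ star T * K ∈ sphereIdeal s}
      mul_mem' := fun {a b} ha hb K hK => by
        rw [star_mul, mul_assoc, mul_assoc]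
        exact ⟨(ha _ (hb K hK).1).1, (hb _ (ha K hK).2).2⟩
      add_mem' := fun {a b} ha hb K hK => by
        rw [star_add, add_mul, add_mul]
        exact ⟨add_mem (ha K hK).1 (hb K hK).1, add_mem (ha K hK).2 (hb K hK).2⟩
      algebraMap_mem' := fun c K hK => by
        rw [← algebraMap_star_comm, ← Algebra.smul_def, ← Algebra.smul_def]
        exact ⟨Submodule.smul_mem _ _ hK, Submodule.smul_mem _ _ hK⟩
      star_mem' := fun {a} ha K hK => by
        rw [star_star]
        exact (ha K hK).symm }
  have hcl : IsClosed (L : Set (BddOp (L2 ℤ))) := by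
    have : (L : Set (BddOp (L2 ℤ))) = ⋂ K ∈ sphereIdeal s,
        ((fun T => T * K) ⁻¹' (sphereIdeal s : Set (BddOp (L2 ℤ))) ∩
          (fun T => star T * K) ⁻¹' (sphereIdeal s : Set (BddOp (L2 ℤ)))) := by
      ext T
      rw [Set.mem_iInter₂]
      rfl
    rw [this]
    exact isClosed_biInter fun K _ =>
      (isClosed_sphereIdeal.preimage (continuous_mul_const K)).inter
        (isClosed_sphereIdeal.preimage ((continuous_mul_const K).comp continuous_star))
  have hle : HS s ≤ L := by
    refine StarSubalgebra.topologicalClosure_minimal (StarAlgebra.adjoin_le ?_) hcl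
    rintro _ (rfl | ⟨f, rfl⟩)
    · exact fun K hK => ⟨opV_mul_mem_sphereIdeal hK, star_opV_mul_mem_sphereIdeal hK⟩
    · exact fun K hK => ⟨opM_mul_mem_sphereIdeal f hK, by
        rw [star_opM]; exact opM_mul_mem_sphereIdeal _ hK⟩
  exact (hle hT K hK).1

theorem mem_sphereIdeal_mul {T K : BddOp (L2 ℤ)} (hT : T ∈ HS s) (hK : K ∈ sphereIdeal s) :
    K * T ∈ sphereIdeal s := by
  rw [← star_star (K * T), star_mul]
  exact star_mem_sphereIdeal (mul_mem_sphereIdeal (star_mem hT) (star_mem_sphereIdeal hK))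

theorem one_sub_opV_pow_mem_sphereIdeal (n : ℕ) :
    1 - opV s ^ n * star (opV s) ^ n ∈ sphereIdeal s := by
  induction n with
  | zero => rw [pow_zero, pow_zero, mul_one, sub_self]; exact zero_mem _
  | succ n ih =>
    -- Telescoping: consecutive projections differ by `V ^ n (1 - V V*) V* ^ n`, a monomial of the
    -- ideal.
    have h : 1 - opV s ^ (n + 1) * star (opV s) ^ (n + 1) =
        (1 - opV s ^ n * star (opV s) ^ n) +
          opV s ^ n * opM (sphereIndicator s) * star (opV s) ^ n := by
      rw [← one_sub_opV_mul_star_opV, pow_succ, pow_succ' (star (opV s))]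
      noncomm_ring
    rw [h]
    exact add_mem ih (monomial_mem_sphereIdeal n n fun x hx => sphereIndicator_of_notMem hx)

theorem norm_opV_le : ‖opV s‖ ≤ 1 :=
  ContinuousLinearMap.opNorm_le_bound _ zero_le_one fun x => by
    rw [one_mul, opV, basisShift_isometry]

theorem norm_opV_pow_le (n : ℕ) : ‖opV s ^ n‖ ≤ 1 := by
  induction n with
  | zero => exact ContinuousLinearMap.norm_id_le
  | succ n ih =>
    rw [pow_succ]
    exact (norm_mul_le _ _).trans (mul_le_one₀ ih (norm_nonneg _) norm_opV_le)

/-- The projections `1 - V ^ n V* ^ n` form an approximate unit of the ideal. -/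
theorem mem_sphereIdeal_of_tendsto {T : BddOp (L2 ℤ)} (hT : T ∈ HS s)
    (h : Tendsto (fun n => T * opV s ^ n) atTop (𝓝 0)) : T ∈ sphereIdeal s := by
  have h1 : Tendsto (fun n => T * (1 - opV s ^ n * star (opV s) ^ n)) atTop (𝓝 T) := by
    rw [tendsto_iff_norm_sub_tendsto_zero]
    refine squeeze_zero (fun _ => norm_nonneg _) (fun n => ?_) (tendsto_zero_iff_norm_tendsto_zero.1 h)
    have : T * (1 - opV s ^ n * star (opV s) ^ n) - T =
        -(T * opV s ^ n * star (opV s ^ n)) := by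
      rw [star_pow]; noncomm_ring
    rw [this, norm_neg]
    refine (norm_mul_le _ _).trans (mul_le_of_le_one_right (norm_nonneg _) ?_)
    rw [norm_star]
    exact norm_opV_pow_le n
  exact isClosed_sphereIdeal.mem_of_tendsto h1
    (Eventually.of_forall fun n => mul_mem_sphereIdeal hT (one_sub_opV_pow_mem_sphereIdeal n))

/-- Moving `V ^ n` to the left replaces `f - f 0` by its values on `s ^ n ℤ_s`, which tend to zero
uniformly. -/
theorem opM_sub_mem_sphereIdeal (f : C(SAdicInt s, ℂ)) :
    opM f - algebraMap ℂ _ (f 0) ∈ sphereIdeal s := by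
  refine mem_sphereIdeal_of_tendsto (sub_mem (opM_mem f) (algebraMap_mem _ _)) ?_
  rw [← opM_sub_algebraMap]
  simp only [opM_mul_opV_pow]
  rw [Metric.tendsto_nhds]
  intro ε hε
  have hU : {x : SAdicInt s | dist (f x) (f 0) < ε / 2} ∈ 𝓝 (0 : SAdicInt s) :=
    Metric.tendsto_nhds.1 (f.continuous.tendsto 0) _ (half_pos hε)
  filter_upwards [eventually_pow_mul_mem hU] with n hn
  rw [dist_zero_right]
  refine lt_of_le_of_lt ?_ (half_lt_self hε)
  refine (norm_mul_le _ _).trans ((mul_le_of_le_one_left (norm_nonneg _)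
    (norm_opV_pow_le n)).trans ((norm_opM_le _).trans ?_))
  rw [ContinuousMap.norm_le _ (half_pos hε).le]
  intro x
  have := hn x
  rw [dist_eq_norm] at this
  exact this.le

/-- For the monomial `h` of degree `b`, both terms times `V ^ n` equal `toeplitz s g * V ^ (b + n)`
once `b + n ≥ 0`, so the approximate unit criterion applies. General `h` follows by density. -/
theorem toeplitz_mul_sub_mem_sphereIdeal (g h : C(UnitAddCircle, ℂ)) :
    toeplitz s g * toeplitz s h - toeplitz s (g * h) ∈ sphereIdeal s := by
  obtain ⟨A, hA⟩ : ∃ A : C(UnitAddCircle, ℂ) →ₗ[ℂ] BddOp (L2 ℤ),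
      ∀ h, A h = toeplitz s g * toeplitz s h - toeplitz s (g * h) :=
    ⟨LinearMap.mulLeft ℂ (toeplitz s g) ∘ₗ toeplitz s - toeplitz s ∘ₗ LinearMap.mulLeft ℂ g,
      fun h => rfl⟩
  have hcont : Continuous A := by
    rw [show (A : C(UnitAddCircle, ℂ) → BddOp (L2 ℤ)) = _ from funext hA]
    exact (continuous_const.mul (continuous_toeplitz s)).sub
      ((continuous_toeplitz s).comp (continuous_const_mul g))
  rw [← hA]
  refine mem_of_forall_fourier_mem (S := (sphereIdeal s).comap A)
    (isClosed_sphereIdeal.preimage hcont) (fun b => ?_) h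
  rw [Submodule.mem_comap, hA]
  refine mem_sphereIdeal_of_tendsto (sub_mem (mul_mem (toeplitz_mem_HS s g) (toeplitz_mem_HS s _))
    (toeplitz_mem_HS s _)) (tendsto_const_nhds.congr' ?_)
  filter_upwards [eventually_ge_atTop b.natAbs] with n hn
  obtain ⟨m, hm⟩ : ∃ m : ℕ, b + n = m := ⟨(b + n).toNat, by omega⟩
  rw [sub_mul, mul_assoc, ← toeplitz_mul_fourier, ← toeplitz_mul_fourier, mul_assoc,
    ← fourier_add_eq_mul, hm, toeplitz_mul_fourier, toeplitz_fourier, sub_self]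

theorem sphereIdeal_le_HS : sphereIdeal s ≤ Subalgebra.toSubmodule (HS s).toSubalgebra := by
  refine sphereIdeal_le (isClosed_HS s) ?_
  rintro _ ⟨i, j, f, -, rfl⟩
  change _ ∈ HS s
  exact mul_mem (mul_mem (pow_mem (opV_mem s) i) (opM_mem f)) (pow_mem (star_mem (opV_mem s)) j)

theorem sub_toeplitz_mem_sphereIdeal (T : HS s) :
    (T : BddOp (L2 ℤ)) - toeplitz s (piZero s T) ∈ sphereIdeal s := by
  let G : StarSubalgebra ℂ (BddOp (L2 ℤ) × C(UnitAddCircle, ℂ)) :=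
    { carrier := {p | p ∈ limitGraph s ∧ p.1 ∈ HS s ∧ p.1 - toeplitz s p.2 ∈ sphereIdeal s}
      mul_mem' := fun {p q} hp hq => by
        refine ⟨mul_mem hp.1 hq.1, mul_mem hp.2.1 hq.2.1, ?_⟩
        -- The first two terms lie in the ideal by two-sidedness, the last because the section is
        -- multiplicative modulo the ideal.
        have : (p * q).1 - toeplitz s (p * q).2 = p.1 * (q.1 - toeplitz s q.2) +
            (p.1 - toeplitz s p.2) * toeplitz s q.2 +
            (toeplitz s p.2 * toeplitz s q.2 - toeplitz s (p.2 * q.2)) := by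
          rw [Prod.fst_mul, Prod.snd_mul]; noncomm_ring
        rw [this]
        exact add_mem (add_mem (mul_mem_sphereIdeal hp.2.1 hq.2.2)
          (mem_sphereIdeal_mul (toeplitz_mem_HS s _) hp.2.2)) (toeplitz_mul_sub_mem_sphereIdeal _ _)
      add_mem' := fun {p q} hp hq => by
        refine ⟨add_mem hp.1 hq.1, add_mem hp.2.1 hq.2.1, ?_⟩
        rw [Prod.fst_add, Prod.snd_add, map_add, add_sub_add_comm]
        exact add_mem hp.2.2 hq.2.2
      algebraMap_mem' := fun c => by
        refine ⟨algebraMap_mem _ c, algebraMap_mem (HS s) c, ?_⟩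
        rw [Prod.algebraMap_apply, Algebra.algebraMap_eq_smul_one, Algebra.algebraMap_eq_smul_one,
          map_smul, toeplitz_one, sub_self]
        exact zero_mem _
      star_mem' := fun {p} hp => by
        refine ⟨star_mem hp.1, star_mem hp.2.1, ?_⟩
        rw [Prod.fst_star, Prod.snd_star, toeplitz_star, ← star_sub]
        exact star_mem_sphereIdeal hp.2.2 }
  have hcl : IsClosed (G : Set (BddOp (L2 ℤ) × C(UnitAddCircle, ℂ))) :=
    (isClosed_limitGraph s).inter (((isClosed_HS s).preimage continuous_fst).inter
      (isClosed_sphereIdeal.preimage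
        (continuous_fst.sub ((continuous_toeplitz s).comp continuous_snd))))
  obtain ⟨g, hg⟩ := exists_mem_of_le_limitGraph (G := G) (fun p hp => hp.1) hcl
    ⟨mem_limitGraph_opV s, opV_mem s, by
      have h := toeplitz_fourier s 1
      rw [Nat.cast_one, pow_one] at h
      rw [h, sub_self]
      exact zero_mem _⟩
    (fun f => ⟨mem_limitGraph_opM f, opM_mem f, by
      rw [Algebra.algebraMap_eq_smul_one (A := C(UnitAddCircle, ℂ)), map_smul, toeplitz_one,
        ← Algebra.algebraMap_eq_smul_one]
      exact opM_sub_mem_sphereIdeal f⟩) T.2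
  have h : piZero s T = g := piZeroFun_eq hg.1 rfl
  rw [h]
  exact hg.2.2

omit [Fact (2 ≤ s)] in
theorem zero_notMem_unitSphere : (0 : SAdicInt s) ∉ UnitSphere s := fun h => h rfl

theorem mem_limitGraph_of_mem_sphereIdeal {T : BddOp (L2 ℤ)} (hT : T ∈ sphereIdeal s) :
    (T, 0) ∈ limitGraph s := by
  refine sphereIdeal_le (S := (Subalgebra.toSubmodule (limitGraph s).toSubalgebra).comap
    (LinearMap.inl ℂ _ _)) ((isClosed_limitGraph s).preimage (by
      change Continuous fun T => (T, (0 : C(UnitAddCircle, ℂ)))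
      fun_prop)) ?_ hT
  rintro _ ⟨i, j, f, hf, rfl⟩
  have h := mul_mem (mul_mem (pow_mem (mem_limitGraph_opV s) i) (mem_limitGraph_opM f))
    (pow_mem (star_mem (mem_limitGraph_opV s)) j)
  rw [hf 0 zero_notMem_unitSphere, map_zero] at h
  have h2 : (opV s, fourier 1) ^ i * (opM f, 0) * star (opV s, fourier 1) ^ j =
      (opV s ^ i * opM f * star (opV s) ^ j, (0 : C(UnitAddCircle, ℂ))) :=
    Prod.ext rfl (by simp)
  rw [h2] at h
  exact h

/-- Monomials of the ideal map to multiples of `f 0 = 0`; conversely `T` differs from the section of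
`piZero s T` by an element of the ideal. -/
theorem piZero_eq_zero_iff (T : HS s) : piZero s T = 0 ↔ (T : BddOp (L2 ℤ)) ∈ sphereIdeal s := by
  refine ⟨fun h => ?_, fun h => piZeroFun_eq (mem_limitGraph_of_mem_sphereIdeal h) rfl⟩
  have := sub_toeplitz_mem_sphereIdeal T
  rwa [h, map_zero, sub_zero] at this

end Ideal

/-! ### The ideal as an image of the compact sections -/

section Orbit

theorem inner_basisInclusion_of_notMem {ι κ : Type} (φ : ι → κ) (hφ : Function.Injective φ) {k : κ}
    (hk : k ∉ Set.range φ) (x : L2 ι) : inner ℂ (basisVec k) (basisInclusion φ hφ x) = 0 := by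
  classical
  have h : innerSL ℂ (basisVec k : L2 κ) ∘L (basisInclusion φ hφ).toContinuousLinearMap = 0 :=
    ext_basisVec fun l => by
      change inner ℂ (basisVec k : L2 κ) (basisInclusion φ hφ (basisVec l)) = 0
      rw [basisInclusion_basisVec, inner_basisVec_basisVec, if_neg fun h => hk ⟨l, h.symm⟩]
  exact DFunLike.congr_fun h x

theorem inner_basisInclusion_of_disjoint {ι κ : Type} {φ ψ : ι → κ} (hφ : Function.Injective φ)
    (hψ : Function.Injective ψ) (h : ∀ i j, φ i ≠ ψ j) (x y : L2 ι) :
    inner ℂ (basisInclusion φ hφ x) (basisInclusion ψ hψ y) = 0 := by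
  have h1 : innerSL ℂ (basisInclusion ψ hψ y) ∘L (basisInclusion φ hφ).toContinuousLinearMap = 0 :=
    ext_basisVec fun l => by
      change inner ℂ (basisInclusion ψ hψ y) (basisInclusion φ hφ (basisVec l)) = 0
      rw [basisInclusion_basisVec, inner_eq_zero_symm]
      exact inner_basisInclusion_of_notMem _ _ (fun ⟨j, hj⟩ => h l j hj.symm) y
  exact inner_eq_zero_symm.1 (DFunLike.congr_fun h1 x)

variable (s : ℕ) [Fact (2 ≤ s)]

/-- The integers that are not divisible by `s`. -/
abbrev NonMultiple (s : ℕ) : Type := {m : ℤ // ¬ (s : ℤ) ∣ m}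

/-- The non-multiples of `s` as elements of the unit sphere. -/
def toUnitSphere (m : NonMultiple s) : UnitSphere s := ⟨(m.1 : SAdicInt s), (intCast_mem_unitSphere _).2 m.2⟩

theorem denseRange_toUnitSphere : DenseRange (toUnitSphere s) := by
  rintro ⟨x, hx⟩
  rw [mem_closure_iff_nhds]
  intro U hU
  rw [mem_nhds_subtype] at hU
  obtain ⟨W, hW, hWU⟩ := hU
  obtain ⟨N, hN⟩ := exists_forall_mem_of_coord_eq hW
  have hs : NeZero s := instNeZeroOfTwoLe s
  -- A representative of `x` modulo `s ^ max N 1`: `N` gives the approximation, and `1` preserves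
  -- the nonzero residue modulo `s`.
  let m : ℤ := ((x.1 (max N 1)).val : ℤ)
  have hm : ((m : ℤ) : SAdicInt s).1 (max N 1) = x.1 (max N 1) := by
    change ((m : ℤ) : ZMod (s ^ max N 1)) = _
    simp [m]
  have hmem : ((m : ℤ) : SAdicInt s) ∈ UnitSphere s := by
    change ((m : ℤ) : SAdicInt s).1 1 ≠ 0
    rw [sAdicInt_coord_eq_of_le (le_max_right N 1) hm]
    exact hx
  exact ⟨⟨(m : SAdicInt s), hmem⟩,
    hWU (hN _ (sAdicInt_coord_eq_of_le (le_max_left N 1) hm)),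
    ⟨m, (intCast_mem_unitSphere _).1 hmem⟩, rfl⟩

variable {s}

theorem pow_mul_eq_pow_mul {a b : ℕ} {m m' : NonMultiple s}
    (h : (s : ℤ) ^ a * m = (s : ℤ) ^ b * m') : a = b ∧ m = m' := by
  have hs : (s : ℤ) ≠ 0 := Int.natCast_ne_zero.mpr (NeZero.ne s)
  have key {a b : ℕ} {m m' : NonMultiple s} (h : (s : ℤ) ^ a * m = (s : ℤ) ^ b * m') : a ≤ b := by
    by_contra! hab
    obtain ⟨c, rfl⟩ := Nat.exists_eq_add_of_lt hab
    rw [pow_add, pow_add, mul_assoc, mul_assoc] at h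
    have h2 := mul_left_cancel₀ (pow_ne_zero _ hs) h
    exact m'.2 ⟨(s : ℤ) ^ c * m, by rw [← h2]; ring⟩
  have hab : a = b := le_antisymm (key h) (key h.symm)
  subst hab
  exact ⟨rfl, Subtype.ext (mul_left_cancel₀ (pow_ne_zero _ hs) h)⟩

theorem exists_eq_pow_mul_nonMultiple {l : ℤ} (hl : l ≠ 0) :
    ∃ (k : ℕ) (m : NonMultiple s), l = (s : ℤ) ^ k * m := by
  have hs : 2 ≤ s := Fact.out
  have hf : FiniteMultiplicity (s : ℤ) l := Int.finiteMultiplicity_iff.2 ⟨by simp; omega, hl⟩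
  obtain ⟨c, hc, hcs⟩ := hf.exists_eq_pow_mul_and_not_dvd
  exact ⟨_, ⟨c, hcs⟩, hc⟩

/-- The isometry `E_j ↦ E_{s ^ ν(j) m}`, with `ν` a bijection of `ℤ` and `ℕ`. -/
def orbitFamily (m : NonMultiple s) : L2 ℤ →ₗᵢ[ℂ] L2 ℤ :=
  basisInclusion (fun j : ℤ => (s : ℤ) ^ Equiv.intEquivNat j * m)
    fun _ _ h => Equiv.intEquivNat.injective (pow_mul_eq_pow_mul h).1

theorem orbitFamily_basisVec (m : NonMultiple s) (j : ℤ) :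
    orbitFamily m (basisVec j) = basisVec ((s : ℤ) ^ Equiv.intEquivNat j * m) :=
  basisInclusion_basisVec _ _ j

theorem orthogonalFamily_orbitFamily :
    OrthogonalFamily ℂ (fun _ : NonMultiple s => L2 ℤ) orbitFamily := fun _ _ hm x y =>
  inner_basisInclusion_of_disjoint _ _ (fun _ _ h => hm (pow_mul_eq_pow_mul h).2) x y

theorem opV_pow_basisVec (k : ℕ) (l : ℤ) :
    (opV s ^ k) (basisVec l) = basisVec ((s : ℤ) ^ k * l) := by
  induction k with
  | zero => simp
  | succ k ih => rw [pow_succ', mul_apply_eq_comp, ih, opV_basisVec, pow_succ', mul_assoc]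

theorem star_opV_pow_basisVec_mul (k : ℕ) (l : ℤ) :
    (star (opV s) ^ k) (basisVec ((s : ℤ) ^ k * l)) = basisVec l := by
  induction k with
  | zero => simp
  | succ k ih => rw [pow_succ, mul_apply_eq_comp, pow_succ', mul_assoc, star_opV_basisVec_mul, ih]

theorem opM_basisVec_eq_zero {f : C(SAdicInt s, ℂ)} (hf : ∀ x ∉ UnitSphere s, f x = 0) {l : ℤ}
    (hl : (s : ℤ) ∣ l) : opM f (basisVec l) = 0 := by
  rw [opM_basisVec, hf _ (by rwa [intCast_mem_unitSphere, not_not]), zero_smul]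

/-- For `a < k` a multiple of `s` remains, which `M_f` kills; for `a > k` one further `V*` kills
`E_m`. -/
theorem opM_star_opV_pow_basisVec {f : C(SAdicInt s, ℂ)} (hf : ∀ x ∉ UnitSphere s, f x = 0)
    (a k : ℕ) (m : NonMultiple s) :
    opM f ((star (opV s) ^ a) (basisVec ((s : ℤ) ^ k * m))) =
      if a = k then f ((m : ℤ) : SAdicInt s) • basisVec (m : ℤ) else 0 := by
  split_ifs with h
  · rw [h, star_opV_pow_basisVec_mul, opM_basisVec]
  · rcases Nat.lt_or_gt_of_ne h with h | h
    · obtain ⟨c, rfl⟩ := Nat.exists_eq_add_of_lt h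
      rw [add_assoc, pow_add, mul_assoc, star_opV_pow_basisVec_mul]
      exact opM_basisVec_eq_zero hf (Dvd.dvd.mul_right (dvd_pow_self _ (Nat.succ_ne_zero c)) _)
    · obtain ⟨c, rfl⟩ := Nat.exists_eq_add_of_lt h
      rw [add_assoc, add_comm, pow_add, mul_apply_eq_comp, star_opV_pow_basisVec_mul, pow_succ,
        mul_apply_eq_comp, star_opV_basisVec_of_not_dvd m.2, map_zero, map_zero]

/-- On the orbit of `m` the monomial is `f m` times a matrix unit, and both sides kill `E_0`.
`Equiv.intEquivNat` relabels orbits indexed by `ℕ`, since the compact operators act on `ℓ²(ℤ)`. -/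
theorem blockRep_orbitFamily_elemSection {f : C(SAdicInt s, ℂ)}
    (hf : ∀ x ∉ UnitSphere s, f x = 0) (i j : ℤ) :
    blockRep orthogonalFamily_orbitFamily (toUnitSphere s)
      (elemSection (f.restrict (UnitSphere s)) (matrixUnit i j)) =
      opV s ^ Equiv.intEquivNat i * opM f * star (opV s) ^ Equiv.intEquivNat j := by
  refine ext_basisVec fun l => ?_
  rw [mul_apply_eq_comp, mul_apply_eq_comp]
  by_cases hl : l = 0
  · subst hl
    have h0 : (star (opV s) ^ Equiv.intEquivNat j) (basisVec 0) = basisVec 0 := by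
      simpa using star_opV_pow_basisVec_mul (s := s) (Equiv.intEquivNat j) 0
    rw [h0, opM_basisVec_eq_zero hf (dvd_zero _), map_zero]
    refine blockRep_apply_of_orthogonal _ _ _ fun m w => ?_
    rw [inner_eq_zero_symm]
    refine inner_basisInclusion_of_notMem _ _ ?_ w
    rintro ⟨k, hk⟩
    refine m.2 ?_
    rcases mul_eq_zero.1 hk with h | h
    · exact absurd h (pow_ne_zero _ (Int.natCast_ne_zero.mpr (NeZero.ne s)))
    · rw [h]; exact dvd_zero _
  · obtain ⟨k, m, rfl⟩ := exists_eq_pow_mul_nonMultiple (s := s) hl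
    rw [opM_star_opV_pow_basisVec hf]
    obtain ⟨k, rfl⟩ := Equiv.intEquivNat.surjective k
    rw [← orbitFamily_basisVec, blockRep_apply_family, elemSection_apply, smul_apply,
      matrixUnit_basisVec]
    simp only [EmbeddingLike.apply_eq_iff_eq]
    split_ifs with h
    · rw [map_smul, map_smul, orbitFamily_basisVec, opV_pow_basisVec]
      rfl
    · simp

/-- Tietze extension, then a cut-off by the indicator, continuous because the sphere is clopen. -/
theorem exists_restrict_unitSphere_eq (f : C(UnitSphere s, ℂ)) :
    ∃ g : C(SAdicInt s, ℂ), (∀ x ∉ UnitSphere s, g x = 0) ∧ g.restrict (UnitSphere s) = f := by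
  obtain ⟨g, hg⟩ := ContinuousMap.exists_restrict_eq (isClosed_unitSphere s) f
  refine ⟨sphereIndicator s * g, fun x hx => ?_, ?_⟩
  · rw [ContinuousMap.mul_apply, sphereIndicator_of_notMem hx, zero_mul]
  · ext x
    have := DFunLike.congr_fun hg x
    rw [ContinuousMap.restrict_apply, ContinuousMap.mul_apply, sphereIndicator_of_mem x.2, one_mul]
    exact this

theorem map_compactSections_orbitFamily :
    (((compactSections (UnitSphere s) ℤ).map
      (blockRep orthogonalFamily_orbitFamily (toUnitSphere s)) :
        NonUnitalStarSubalgebra ℂ (BddOp (L2 ℤ))) : Set (BddOp (L2 ℤ))) = sphereIdeal s := by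
  refine Set.Subset.antisymm ?_ ?_
  · refine map_compactSections_subset _ (denseRange_toUnitSphere s) isClosed_sphereIdeal
      fun f i j => ?_
    obtain ⟨g, hg, rfl⟩ := exists_restrict_unitSphere_eq f
    rw [blockRep_orbitFamily_elemSection hg]
    exact monomial_mem_sphereIdeal _ _ hg
  · refine sphereIdeal_le (S := ((compactSections (UnitSphere s) ℤ).map
      (blockRep orthogonalFamily_orbitFamily (toUnitSphere s))).toSubmodule)
      (isClosed_map_compactSections _ (denseRange_toUnitSphere s)) ?_
    rintro _ ⟨i, j, f, hf, rfl⟩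
    refine ⟨elemSection (f.restrict (UnitSphere s))
      (matrixUnit (Equiv.intEquivNat.symm i) (Equiv.intEquivNat.symm j)),
      elemSection_mem _ (isCompactOperator_matrixUnit _ _), ?_⟩
    have := blockRep_orbitFamily_elemSection hf (Equiv.intEquivNat.symm i) (Equiv.intEquivNat.symm j)
    rwa [Equiv.apply_symm_apply, Equiv.apply_symm_apply] at this

/-- The inclusion of `HS(s)` into the bounded operators. -/
def inclusionHS (s : ℕ) [Fact (2 ≤ s)] : HS s →⋆ₙₐ[ℂ] BddOp (L2 ℤ) := (HS s).subtype

theorem map_starKer_piZero :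
    (starKer (piZero s)).map (inclusionHS s) =
      (compactSections (UnitSphere s) ℤ).map
        (blockRep orthogonalFamily_orbitFamily (toUnitSphere s)) := by
  refine SetLike.coe_injective ?_
  rw [map_compactSections_orbitFamily]
  refine Set.Subset.antisymm ?_ fun T hT => ?_
  · rintro _ ⟨T, hT, rfl⟩
    exact (piZero_eq_zero_iff T).1 hT
  · exact ⟨⟨T, sphereIdeal_le_HS hT⟩, (piZero_eq_zero_iff ⟨T, sphereIdeal_le_HS hT⟩).2 hT, rfl⟩

theorem nonempty_starKer_equiv (s : ℕ) [Fact (2 ≤ s)] :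
    Nonempty (starKer (piZero s) ≃⋆ₐ[ℂ] contTensorCompact s) :=
  nonempty_equiv_of_map_eq (f := inclusionHS s) Subtype.val_injective
    (blockRep_injective orthogonalFamily_orbitFamily (denseRange_toUnitSphere s))
    (blockRep_injective (orthogonalFamily_tensorFamily (UnitSphere s) (L2 ℤ)) denseRange_id)
    map_starKer_piZero (map_compactSections_tensorFamily ℤ)

/-- This makes `toeplitz s` a right inverse of `piZero s`, whence surjectivity; by density and
adjoints it reduces to powers of `V`. -/
theorem mem_limitGraph_toeplitz (s : ℕ) [Fact (2 ≤ s)] (g : C(UnitAddCircle, ℂ)) :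
    (toeplitz s g, g) ∈ limitGraph s := by
  have hn (n : ℕ) : (toeplitz s (fourier n), fourier (n : ℤ)) ∈ limitGraph s := by
    rw [toeplitz_fourier, fourier_natCast]
    exact pow_mem (mem_limitGraph_opV s) n
  refine mem_of_forall_fourier_mem (S := (Subalgebra.toSubmodule
    (limitGraph s).toSubalgebra).comap ((toeplitz s).prod LinearMap.id))
    ((isClosed_limitGraph s).preimage ((continuous_toeplitz s).prodMk continuous_id))
    (fun n => ?_) g
  change (toeplitz s (fourier n), fourier n) ∈ limitGraph s
  obtain ⟨m, rfl | rfl⟩ := n.eq_nat_or_neg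
  · exact hn m
  · have h : (star (toeplitz s (fourier m)), star (fourier (m : ℤ))) =
        star ((toeplitz s (fourier m), fourier (m : ℤ)) :
          BddOp (L2 ℤ) × C(UnitAddCircle, ℂ)) := rfl
    rw [fourier_neg_eq_star, toeplitz_star, h]
    exact (limitGraph s).star_mem' (hn m)

theorem piZero_surjective (s : ℕ) [Fact (2 ≤ s)] : Function.Surjective (piZero s) := fun g =>
  ⟨⟨toeplitz s g, toeplitz_mem_HS s g⟩, piZeroFun_eq (mem_limitGraph_toeplitz s g) rfl⟩

theorem exists_injective_exact_piZero (s : ℕ) [Fact (2 ≤ s)] :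
    ∃ j : contTensorCompact s →⋆ₙₐ[ℂ] HS s,
      Function.Injective j ∧ Function.Exact j (piZero s) ∧ Function.Surjective (piZero s) :=
  (exists_injective_mem_range_iff (nonempty_starKer_equiv s)).imp fun _ h =>
    ⟨h.1, h.2, piZero_surjective s⟩

theorem eq_piZero_iff (π : HS s →⋆ₐ[ℂ] C(UnitAddCircle, ℂ)) :
    π = piZero s ↔ (shiftEquiv s (π (genV s)) : BddOp (L2 ℤ)) = opv ∧
      ∀ f : C(SAdicInt s, ℂ), (shiftEquiv s (π (genM f)) : BddOp (L2 ℤ)) = opm f := by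
  have hV : (shiftEquiv s (piZero s (genV s)) : BddOp (L2 ℤ)) = opv := by
    rw [piZero_genV, shiftEquiv_apply, circleCalculus_fourier_one]
  have hM (f : C(SAdicInt s, ℂ)) : (shiftEquiv s (piZero s (genM f)) : BddOp (L2 ℤ)) = opm f := by
    rw [piZero_genM, shiftEquiv_apply, AlgHomClass.commutes, opm_eq]
  refine ⟨fun h => h ▸ ⟨hV, hM⟩, fun h => ext_HS s ?_ fun f => ?_⟩
  · exact (shiftEquiv s).injective (Subtype.ext (h.1.trans hV.symm))
  · exact (shiftEquiv s).injective (Subtype.ext ((h.2 f).trans (hM f).symm))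

end Orbit

end HenselSteinitz

end

theorem mainTheorem2 (s : ℕ) [Fact (2 ≤ s)] :
    ∃ (Θ : shiftAlg s ≃⋆ₐ[ℂ] C(UnitAddCircle, ℂ)) (π₀ : HS s →⋆ₐ[ℂ] C(UnitAddCircle, ℂ)),
      -- `Θ` identifies the bilateral shift with the function `t ↦ exp (2 π i t)` on `ℝ/ℤ`
      (Θ.symm (fourier 1) : BddOp (L2 ℤ)) = opv ∧
      -- `π₀` sends `V` to `v` and `M_f` to `m_f`, and it is the only such `*`-homomorphism
      (∀ π : HS s →⋆ₐ[ℂ] C(UnitAddCircle, ℂ),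
        π = π₀ ↔
          (Θ.symm (π (genV s)) : BddOp (L2 ℤ)) = opv ∧
            ∀ f : C(SAdicInt s, ℂ), (Θ.symm (π (genM f)) : BddOp (L2 ℤ)) = opm f) ∧
      -- the ideal `I_s = ker π₀` is isomorphic to `C(ℤ_s^×) ⊗ K`
      Nonempty (starKer π₀ ≃⋆ₐ[ℂ] contTensorCompact s) ∧
      -- `0 → C(ℤ_s^×) ⊗ K → HS(s) → C(ℝ/ℤ) → 0` is exact
      ∃ j : contTensorCompact s →⋆ₙₐ[ℂ] HS s,
        Function.Injective j ∧ Function.Exact j π₀ ∧ Function.Surjective π₀ := by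
  refine ⟨(shiftEquiv s).symm, piZero s, ?_, fun π => ?_, nonempty_starKer_equiv s,
    exists_injective_exact_piZero s⟩
  · rw [StarAlgEquiv.symm_symm, shiftEquiv_apply, circleCalculus_fourier_one]
  · rw [StarAlgEquiv.symm_symm]
    exact eq_piZero_iff π
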